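/- \textbf{Setting.} For $d\ge 1$ let $\varphi_d$ be the density of the standard Gaussian measure on $\mathbb R^d$. For $k\in\mathbb N_0$ let $H_k(x)=\frac{(-1)^k}{\sqrt{k!}}e^{x^2/2}\frac{d^k}{dx^k}e^{-x^2/2}$ be the normalized Hermite polynomials, and for $\mathbf k\in\mathbb N_0^d$ let $H_{\mathbf k}(\mathbf x)=\prod_{j=1}^d H_{k_j}(x_j)$. For a Gaussian square-integrable function $f$ let $\hat f(\mathbf k)=\int_{\mathbb R^d}f(\mathbf x)H_{\mathbf k}(\mathbf x)\varphi_d(\mathbf x)\,d\mathbf x$. For a summable $r:\mathbb N_0^d\to(0,\infty)$ let $\|f\|_r=\big(\sum_{\mathbf k}r(\mathbf k)^{-1}|\hat f(\mathbf k)|^2\big)^{1/2}$, and let the Hermite space $\mathcal H_r$ consist of all continuous Gaussian square-integrable $f:\mathbb R^d\to\mathbb R$ with $\|f\|_r<\infty$. Let $I(f)=\int_{\mathbb R^d}f(\mathbf x)\varphi_d(\mathbf x)\,d\mathbf x$. For points $\mathcal P=(\mathbf x_1,\dots,\mathbf x_n)$ in $\mathbb R^d$, $n\ge1$, put $$e_{n,d}(\mathcal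 P,\mathcal H_r)=\sup_{f\in\mathcal H_r,\ \|f\|_r\le1}\Big|I(f)-\frac1n\sum_{i=1}^n f(\mathbf x_i)\Big|,\qquad e_{0,d}(\mathcal H_r)=\sup_{f\in\mathcal H_r,\ \|f\|_r\le1}|I(f)|,$$ and let $n_{\min}(\varepsilon,d;\mathcal H_r)$ be the least $n\ge1$ for which there are $n$ points $\mathcal P$ with $e_{n,d}(\mathcal P,\mathcal H_r)\le\varepsilon\, e_{0,d}(\mathcal H_r)$. Given sequences $\boldsymbol\gamma=(\gamma_1,\gamma_2,\dots)$ and $\boldsymbol\omega=(\omega_1,\omega_2,\dots)$ in $(0,1)$, let $\epsilon_{\boldsymbol\omega,\boldsymbol\gamma}(\mathbf k)=\prod_{j=1}^d\epsilon_{\omega_j,\gamma_j}(k_j)$ for $\mathbf k\in\mathbb N_0^d$, where $\epsilon_{\omega_j,\gamma_j}(0)=1$ and $\epsilon_{\omega_j,\gamma_j}(k)=\gamma_j\omega_j^{k}$ for $k\ge1$. Multivariate (QMC) integration in the weighted Hermite spaces $\mathcal H_{\epsilon_{\boldsymbol\omega,\boldsymbol\gamma}}$ (one for each dimension $d$) is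 called \emph{polynomially tractable} if there are $c,p,q>0$ such that $n_{\min}(\varepsilon,d;\mathcal H_{\epsilon_{\boldsymbol\omega,\boldsymbol\gamma}})\le c\,d^{q}\varepsilon^{-p}$ for all integers $d\ge1$ and all $\varepsilon\in(0,1)$, and \emph{strongly polynomially tractable} if there are $c,p>0$ such that this holds with $q=0$. \textbf{Theorem.} Let $\boldsymbol\gamma\in(0,1)^{\mathbb N}$ be non-increasing and let $\boldsymbol\omega\in(0,1)^{\mathbb N}$ satisfy $\liminf_{d}\omega_d>0$ and $\limsup_{d}\omega_d<1$. Then multivariate integration in $\mathcal H_{\epsilon_{\boldsymbol\omega,\boldsymbol\gamma}}$ is \begin{enumerate} \item strongly polynomially tractable if and only if $\sum_{j=1}^\infty\gamma_j<\infty$; \item polynomially tractable if and only if $\limsup_{d\to\infty}\frac{\sum_{j=1}^d\gamma_j}{\ln d}<\infty$. \end{enumerate} -/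

import Mathlib

namespace HermiteQMC

open MeasureTheory ProbabilityTheory
open scoped ENNReal

/-- The standard Gaussian measure on `ℝ^d` (product of `d` standard normal laws). -/
noncomputable def gaussianMeasure (d : ℕ) : Measure (Fin d → ℝ) :=
  Measure.pi fun _ => gaussianReal 0 1

/-- The normalized (orthonormal) univariate Hermite polynomial
`H_k(x) = (-1)^k / √(k!) * e^{x²/2} * (d/dx)^k e^{-x²/2}`;
`Polynomial.hermite k` is the monic probabilists' Hermite polynomial. -/
noncomputable def hermiteFun (k : ℕ) (x : ℝ) : ℝ :=
  Polynomial.aeval x (Polynomial.hermite k) / Real.sqrt (k.factorial : ℝ)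

theorem hermiteFun_eq_deriv (k : ℕ) (x : ℝ) :
    hermiteFun k x = (-1) ^ k / Real.sqrt (k.factorial : ℝ) * Real.exp (x ^ 2 / 2) *
      iteratedDeriv k (fun y : ℝ => Real.exp (-(y ^ 2 / 2))) x := by
  rw [hermiteFun, Polynomial.hermite_eq_deriv_gaussian', iteratedDeriv_eq_iterate]
  ring

/-- The multivariate Hermite polynomial `H_k(x) = ∏ j, H_{k_j}(x_j)`. -/
noncomputable def hermiteMulti {d : ℕ} (k : Fin d → ℕ) (x : Fin d → ℝ) : ℝ :=
  ∏ j, hermiteFun (k j) (x j)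

/-- The integral `I(f)` with respect to the standard Gaussian measure. -/
noncomputable def gaussianIntegral {d : ℕ} (f : (Fin d → ℝ) → ℝ) : ℝ :=
  ∫ x, f x ∂(gaussianMeasure d)

/-- The `k`-th Hermite coefficient of `f`. -/
noncomputable def hermiteCoeff {d : ℕ} (f : (Fin d → ℝ) → ℝ) (k : Fin d → ℕ) : ℝ :=
  ∫ x, f x * hermiteMulti k x ∂(gaussianMeasure d)

/-- The norm `‖f‖_r = (∑ k, r(k)⁻¹ |f̂(k)|²)^{1/2}`, with values in `[0, ∞]`. -/
noncomputable def hermiteNorm {d : ℕ} (r : (Fin d → ℕ) → ℝ) (f : (Fin d → ℝ) → ℝ) : ℝ≥0∞ :=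
  (∑' k : Fin d → ℕ, ENNReal.ofReal ((r k)⁻¹ * |hermiteCoeff f k| ^ 2)) ^ (1 / 2 : ℝ)

/-- The Hermite space `H_r`: continuous Gaussian square-integrable functions `f` on `ℝ^d` with
`‖f‖_r < ∞` (for a positive summable function `r` of the multi-index). -/
def hermiteSpace {d : ℕ} (r : (Fin d → ℕ) → ℝ) : Set ((Fin d → ℝ) → ℝ) :=
  {f | Continuous f ∧ MemLp f 2 (gaussianMeasure d) ∧ hermiteNorm r f < ∞}

/-- The QMC rule `Q_{n,d}(f, P) = (1/n) ∑ i, f(x_i)`. -/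
noncomputable def qmcRule {d n : ℕ} (P : Fin n → (Fin d → ℝ)) (f : (Fin d → ℝ) → ℝ) : ℝ :=
  (1 / (n : ℝ)) * ∑ i, f (P i)

/-- The worst case error `e_{n,d}(P, H_r)`: the supremum of `|I(f) - Q_{n,d}(f, P)|` over the unit
ball of `H_r`. -/
noncomputable def worstCaseError {d n : ℕ} (r : (Fin d → ℕ) → ℝ) (P : Fin n → (Fin d → ℝ)) :
    ℝ≥0∞ :=
  ⨆ f ∈ {f | f ∈ hermiteSpace r ∧ hermiteNorm r f ≤ 1},
    ENNReal.ofReal |gaussianIntegral f - qmcRule P f|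

/-- The initial error `e_{0,d}(H_r)`: the supremum of `|I(f)|` over the unit ball of `H_r`. -/
noncomputable def initialError {d : ℕ} (r : (Fin d → ℕ) → ℝ) : ℝ≥0∞ :=
  ⨆ f ∈ {f | f ∈ hermiteSpace r ∧ hermiteNorm r f ≤ 1}, ENNReal.ofReal |gaussianIntegral f|

/-- The information complexity `n_min(ε, d; H_r)`: the least `n ≥ 1` such that some `n`-point QMC
rule reduces the initial error by the factor `ε` (`⊤` if there is no such `n`). -/
noncomputable def nMin {d : ℕ} (r : (Fin d → ℕ) → ℝ) (ε : ℝ) : ℕ∞ :=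
  ⨅ n ∈ {n : ℕ | 1 ≤ n ∧ ∃ P : Fin n → (Fin d → ℝ),
    worstCaseError r P ≤ ENNReal.ofReal ε * initialError r}, (n : ℕ∞)

/-- `n_min(ε, d; H_{r_d}) ≤ c d^q ε^{-p}` for all `d ≥ 1` and all `ε ∈ (0, 1)`. -/
def TractabilityBound (r : (d : ℕ) → (Fin d → ℕ) → ℝ) (c p q : ℝ) : Prop :=
  ∀ d : ℕ, 1 ≤ d → ∀ ε : ℝ, 0 < ε → ε < 1 →
    ((nMin (r d) ε : ℕ∞) : ℝ≥0∞) ≤ ENNReal.ofReal (c * (d : ℝ) ^ q * ε ^ (-p))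

/-- QMC integration in the spaces `H_{r_d}`, `d ≥ 1`, is polynomially tractable. -/
def PolynomiallyTractable (r : (d : ℕ) → (Fin d → ℕ) → ℝ) : Prop :=
  ∃ c p q : ℝ, 0 < c ∧ 0 < p ∧ 0 < q ∧ TractabilityBound r c p q

/-- QMC integration in the spaces `H_{r_d}`, `d ≥ 1`, is strongly polynomially tractable. -/
def StronglyPolynomiallyTractable (r : (d : ℕ) → (Fin d → ℕ) → ℝ) : Prop :=
  ∃ c p : ℝ, 0 < c ∧ 0 < p ∧ TractabilityBound r c p 0

/-- The univariate weight `ε_{ω,γ}(k)`: `1` if `k = 0`, and `γ ω^k` otherwise. -/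
noncomputable def expWeight (ω γ : ℝ) (k : ℕ) : ℝ :=
  if k = 0 then 1 else γ * ω ^ k

/-- The product weight `ε_{ω,γ}(k) = ∏ j, ε_{ω_j,γ_j}(k_j)` in dimension `d`. The sequences are
indexed from `0`, so that their first `d` entries are used. -/
noncomputable def expWeightMulti (ω γ : ℕ → ℝ) (d : ℕ) (k : Fin d → ℕ) : ℝ :=
  ∏ j : Fin d, expWeight (ω j) (γ j) (k j)

end HermiteQMC

namespace HermiteQMC

open MeasureTheory ProbabilityTheory Filter Topology
open scoped ENNReal NNReal

section

/-! ### Polynomials under the standard Gaussian measure -/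

/-! Both equivalences come from sandwiching the information complexity between quantities of the
form exp(const · ∑_{j<d} γ_j). Since the weight at k = 0 is 1, the initial error is 1
(`initialError_eq_one`), so ε is an absolute error bound.

Upper bound. Every f in the space is the pointwise sum of its Hermite series (`hasSum_hermite`): the
series converges locally uniformly because geometric weights beat the subexponential growth of H_k
on compact sets, and its sum equals f by completeness of the Hermite system and continuity. Hence
the error of a QMC rule on f is the sum of f̂(k) times its error on H_k, and Cauchy–Schwarz bounds
the squared worst-case error by ∑ r(k) err(H_k)². Averaged over n independent Gaussian points this
is (S - 1)/n, where S = ∑ r(k) = ∏ (1 + γ_j ω_j/(1 - ω_j)). So some point set is at least that good,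
n_min ≤ S ε⁻² (`nMin_le`), and S ≤ exp(C ∑ γ_j) when the ω_j stay below some b < 1.

Lower bound. QMC weights are positive and equal, so it is enough to fool one node. A product of
nonnegative polynomials of degree at most 4 in each variable gives f ≥ 0 of norm at most 1 whose
value at that node is at least √M, with M = ∏ (1 + κ γ_j) (`exists_fooling_function`). Then Q(f) ≥
√M/n while I(f) ≤ 1, so error 1/2 forces n ≥ (2/3)√M (`le_nMin`). As log M is at least a constant
times ∑ γ_j when the ω_j stay above some a > 0, a bound on n_min in terms of d bounds the partial
sums of γ. -/

theorem memLp_pow_gaussianReal (n : ℕ) (p : ℝ≥0) :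
    MemLp (fun x : ℝ => x ^ n) p (gaussianReal 0 1) := by
  rcases Nat.eq_zero_or_pos n with rfl | hn
  · simpa using memLp_const (1 : ℝ)
  have h := memLp_id_gaussianReal (μ := 0) (v := 1) (n * p)
  have h2 := h.norm_rpow_div (q := (n : ℝ≥0∞))
  have h3 : ((n * p : ℝ≥0) : ℝ≥0∞) / n = p := by
    push_cast
    rw [mul_comm, ENNReal.mul_div_cancel_right (by positivity) (by simp)]
  rw [h3] at h2
  refine MemLp.of_le h2 (by fun_prop) (ae_of_all _ fun x => ?_)
  simp

theorem memLp_polynomial_gaussianReal (q : Polynomial ℝ) (p : ℝ≥0) :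
    MemLp (fun x : ℝ => q.eval x) p (gaussianReal 0 1) := by
  induction q using Polynomial.induction_on' with
  | add q r hq hr =>
    simp only [Polynomial.eval_add]
    exact hq.add hr
  | monomial n a => simpa using (memLp_pow_gaussianReal n p).const_mul a

theorem integrable_polynomial_gaussianReal (q : Polynomial ℝ) :
    Integrable (fun x : ℝ => q.eval x) (gaussianReal 0 1) :=
  memLp_one_iff_integrable.1 (by exact_mod_cast memLp_polynomial_gaussianReal q 1)

theorem integrable_polynomial_mul_gaussianPDFReal (q : Polynomial ℝ) :
    Integrable (fun x : ℝ => q.eval x * gaussianPDFReal 0 1 x) := by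
  have h := integrable_polynomial_gaussianReal q
  rw [gaussianReal_of_var_ne_zero _ one_ne_zero,
    integrable_withDensity_iff_integrable_smul' (measurable_gaussianPDF 0 1)
      (ae_of_all _ fun _ => gaussianPDF_lt_top)] at h
  simpa [toReal_gaussianPDF, mul_comm] using h

theorem hasDerivAt_gaussianPDFReal (x : ℝ) :
    HasDerivAt (gaussianPDFReal 0 1) (-x * gaussianPDFReal 0 1 x) x := by
  unfold gaussianPDFReal
  have h : HasDerivAt (fun y : ℝ => -(y - 0) ^ 2 / (2 * ((1 : ℝ≥0) : ℝ))) (-x) x := by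
    have := (((hasDerivAt_id x).sub_const 0).pow 2).neg.div_const (2 * ((1 : ℝ≥0) : ℝ))
    refine this.congr_deriv ?_
    simp
    ring
  refine (h.exp.const_mul _).congr_deriv ?_
  ring

/-- Gaussian integration by parts for polynomials. -/
theorem integral_X_mul_gaussianReal (q : Polynomial ℝ) :
    ∫ x, (Polynomial.X * q).eval x ∂(gaussianReal 0 1)
      = ∫ x, q.derivative.eval x ∂(gaussianReal 0 1) := by
  rw [integral_gaussianReal_eq_integral_smul one_ne_zero,
    integral_gaussianReal_eq_integral_smul one_ne_zero]
  have h := integral_mul_deriv_eq_deriv_mul_of_integrable (u := fun x : ℝ => q.eval x)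
    (u' := fun x => q.derivative.eval x) (v := gaussianPDFReal 0 1)
    (v' := fun x => -x * gaussianPDFReal 0 1 x)
    (fun x _ => q.hasDerivAt x) (fun x _ => hasDerivAt_gaussianPDFReal x)
    (by
      refine (integrable_polynomial_mul_gaussianPDFReal (-(Polynomial.X * q))).congr
        (ae_of_all _ fun x => ?_)
      simp
      ring)
    (integrable_polynomial_mul_gaussianPDFReal _) (integrable_polynomial_mul_gaussianPDFReal _)
  have h2 := congrArg Neg.neg h
  rw [neg_neg, ← integral_neg] at h2
  refine Eq.trans (integral_congr_ae (ae_of_all _ fun x => ?_)) (h2.trans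
    (integral_congr_ae (ae_of_all _ fun x => ?_)))
  · simp only [smul_eq_mul, Polynomial.eval_mul, Polynomial.eval_X]
    ring
  · simp only [smul_eq_mul]
    ring

/-! ### Univariate Hermite polynomials -/

/-- The monic Hermite polynomial with real coefficients. -/
noncomputable def hermiteReal (k : ℕ) : Polynomial ℝ :=
  (Polynomial.hermite k).map (Int.castRingHom ℝ)

theorem hermiteReal_succ (k : ℕ) :
    hermiteReal (k + 1) = Polynomial.X * hermiteReal k - (hermiteReal k).derivative := by
  simp [hermiteReal, Polynomial.hermite_succ, Polynomial.derivative_map]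

theorem hermiteReal_zero : hermiteReal 0 = 1 := by simp [hermiteReal]

theorem monic_hermiteReal (k : ℕ) : (hermiteReal k).Monic :=
  (Polynomial.hermite_monic k).map _

theorem natDegree_hermiteReal (k : ℕ) : (hermiteReal k).natDegree = k := by
  rw [hermiteReal, (Polynomial.hermite_monic k).natDegree_map, Polynomial.natDegree_hermite]

/-- Differentiate the recursion; the induction hypothesis turns the second derivative into a
multiple of the derivative of the preceding polynomial, and the recursion reassembles the terms. -/
theorem derivative_hermiteReal (k : ℕ) :
    (hermiteReal (k + 1)).derivative = ((k : ℝ) + 1) • hermiteReal k := by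
  induction k with
  | zero => simp [hermiteReal_succ, hermiteReal_zero]
  | succ k ih =>
    rw [hermiteReal_succ (k + 1), Polynomial.derivative_sub, Polynomial.derivative_mul, ih,
      Polynomial.derivative_smul]
    nth_rewrite 2 [hermiteReal_succ k]
    have h := hermiteReal_succ k
    simp only [Polynomial.smul_eq_C_mul, Polynomial.derivative_X, one_mul]
    push_cast
    simp only [Polynomial.C_add, Polynomial.C_1]
    rw [h]
    ring

theorem hermiteFun_eq (k : ℕ) (x : ℝ) :
    hermiteFun k x = (hermiteReal k).eval x / Real.sqrt (k.factorial : ℝ) := by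
  rw [hermiteFun, hermiteReal, Polynomial.eval_map, Polynomial.aeval_def]
  rfl

theorem hermiteFun_eq_eval (k : ℕ) (x : ℝ) :
    hermiteFun k x =
      (Polynomial.C (Real.sqrt (k.factorial : ℝ))⁻¹ * hermiteReal k).eval x := by
  rw [hermiteFun_eq, Polynomial.eval_mul, Polynomial.eval_C, div_eq_inv_mul]

theorem continuous_hermiteFun (k : ℕ) : Continuous (hermiteFun k) := by
  have : hermiteFun k = fun x => (hermiteReal k).eval x / Real.sqrt (k.factorial : ℝ) :=
    funext (hermiteFun_eq k)
  rw [this]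
  fun_prop

theorem memLp_hermiteFun (k : ℕ) (p : ℝ≥0) : MemLp (hermiteFun k) p (gaussianReal 0 1) := by
  rw [show hermiteFun k = _ from funext (hermiteFun_eq_eval k)]
  exact memLp_polynomial_gaussianReal _ _

/-- Iterated integration by parts: the factor X in X · (H_k q) becomes the derivative H_k' q + H_k
q', whose first term cancels against the -H_k' q of the recursion. Orthogonality and the value k! of
the squared norm follow by taking q of degree at most k. -/
theorem integral_hermiteReal_mul (k : ℕ) (q : Polynomial ℝ) :
    ∫ x, (hermiteReal k * q).eval x ∂(gaussianReal 0 1)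
      = ∫ x, (Polynomial.derivative^[k] q).eval x ∂(gaussianReal 0 1) := by
  induction k generalizing q with
  | zero => simp [hermiteReal_zero]
  | succ k ih =>
    rw [Function.iterate_succ_apply, ← ih]
    have h1 : hermiteReal (k + 1) * q
        = Polynomial.X * (hermiteReal k * q) - (hermiteReal k).derivative * q := by
      rw [hermiteReal_succ]; ring
    have h2 := integral_X_mul_gaussianReal (hermiteReal k * q)
    rw [h1]
    simp_rw [Polynomial.eval_sub]
    rw [integral_sub (integrable_polynomial_gaussianReal _) (integrable_polynomial_gaussianReal _),
      h2, ← integral_sub (integrable_polynomial_gaussianReal _)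
      (integrable_polynomial_gaussianReal _)]
    congr 1
    ext x
    simp [Polynomial.derivative_mul]

theorem integral_hermiteReal_mul_self (k : ℕ) :
    ∫ x, (hermiteReal k * hermiteReal k).eval x ∂(gaussianReal 0 1) = k.factorial := by
  rw [integral_hermiteReal_mul]
  have h : Polynomial.derivative^[k] (hermiteReal k) = Polynomial.C (k.factorial : ℝ) := by
    ext n
    rw [Polynomial.coeff_iterate_derivative, Polynomial.coeff_C]
    split_ifs with hn
    · subst hn
      have := monic_hermiteReal k
      rw [Polynomial.Monic, Polynomial.leadingCoeff, natDegree_hermiteReal] at this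
      simp [this, Nat.descFactorial_self]
    · rw [Polynomial.coeff_eq_zero_of_natDegree_lt]
      · simp
      · rw [natDegree_hermiteReal]; omega
  simp [h]

theorem integral_hermiteReal_mul_of_lt {k l : ℕ} (h : l < k) :
    ∫ x, (hermiteReal k * hermiteReal l).eval x ∂(gaussianReal 0 1) = 0 := by
  rw [integral_hermiteReal_mul,
    Polynomial.iterate_derivative_eq_zero (by rwa [natDegree_hermiteReal])]
  simp

theorem integral_hermiteFun_mul (k l : ℕ) :
    ∫ x, hermiteFun k x * hermiteFun l x ∂(gaussianReal 0 1) = if k = l then 1 else 0 := by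
  have h : ∀ k l x, hermiteFun k x * hermiteFun l x = (Real.sqrt (k.factorial : ℝ))⁻¹ *
      (Real.sqrt (l.factorial : ℝ))⁻¹ * (hermiteReal k * hermiteReal l).eval x := by
    intro k l x
    rw [hermiteFun_eq, hermiteFun_eq, Polynomial.eval_mul]
    ring
  simp_rw [h, integral_const_mul]
  rcases lt_trichotomy k l with hkl | rfl | hkl
  · rw [mul_comm (hermiteReal k), integral_hermiteReal_mul_of_lt hkl, if_neg hkl.ne]
    simp
  · rw [integral_hermiteReal_mul_self, if_pos rfl, ← mul_inv,
      Real.mul_self_sqrt (by positivity)]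
    exact inv_mul_cancel₀ (by positivity)
  · rw [integral_hermiteReal_mul_of_lt hkl, if_neg hkl.ne']
    simp

theorem hermiteFun_zero (x : ℝ) : hermiteFun 0 x = 1 := by simp [hermiteFun]

theorem hermiteFun_one (x : ℝ) : hermiteFun 1 x = x := by simp [hermiteFun]

/-! ### Three-term recurrence and local growth in the degree -/

theorem sqrt_mul_hermiteFun_succ (k : ℕ) (x : ℝ) :
    Real.sqrt ((k : ℝ) + 2) * hermiteFun (k + 2) x
      = x * hermiteFun (k + 1) x - Real.sqrt ((k : ℝ) + 1) * hermiteFun k x := by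
  have h0 : (0 : ℝ) < k.factorial := by positivity
  have e1 : Real.sqrt ((k + 1).factorial : ℝ)
      = Real.sqrt ((k : ℝ) + 1) * Real.sqrt (k.factorial : ℝ) := by
    rw [← Real.sqrt_mul (by positivity), Nat.factorial_succ]; push_cast; rfl
  have e2 : Real.sqrt ((k + 2).factorial : ℝ)
      = Real.sqrt ((k : ℝ) + 2) * Real.sqrt ((k + 1).factorial : ℝ) := by
    rw [← Real.sqrt_mul (by positivity), Nat.factorial_succ (k + 1)]; push_cast; congr 1; ring
  have s1 : Real.sqrt ((k : ℝ) + 1) ^ 2 = k + 1 := Real.sq_sqrt (by positivity)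
  have p1 : 0 < Real.sqrt ((k : ℝ) + 1) := by positivity
  have p2 : 0 < Real.sqrt ((k : ℝ) + 2) := by positivity
  have p0 : 0 < Real.sqrt (k.factorial : ℝ) := by positivity
  rw [hermiteFun_eq, hermiteFun_eq, hermiteFun_eq, hermiteReal_succ (k + 1),
    derivative_hermiteReal, e2, e1]
  simp only [Polynomial.eval_sub, Polynomial.eval_mul, Polynomial.eval_X, Polynomial.eval_smul,
    smul_eq_mul]
  field_simp
  rw [s1]
  ring

/-- A majorant of `H_k(x)² + H_{k+1}(x)²` on `[-R, R]`, growing subexponentially in `k`. -/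
noncomputable def hermiteBound (R : ℝ) : ℕ → ℝ
  | 0 => 1 + R ^ 2
  | k + 1 => (1 + R / Real.sqrt ((k : ℝ) + 2) + (R / Real.sqrt ((k : ℝ) + 2)) ^ 2) *
      hermiteBound R k

theorem hermiteBound_pos {R : ℝ} (hR : 0 ≤ R) (k : ℕ) : 0 < hermiteBound R k := by
  induction k with
  | zero => rw [hermiteBound]; positivity
  | succ k ih => rw [hermiteBound]; positivity

/-- With s = √(k+2), the recurrence sends (u, v) to (δu - cv, u), where |δ| ≤ Δ = R/s and 0 ≤ c ≤ 1.
At δ = 0 this map does not increase the squared length; the cross term costs at most a factor Δ and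
the square of δ a factor Δ². -/
theorem hermiteFun_sq_add_sq_le {R x : ℝ} (hx : |x| ≤ R) (k : ℕ) :
    hermiteFun k x ^ 2 + hermiteFun (k + 1) x ^ 2 ≤ hermiteBound R k := by
  have hR : 0 ≤ R := (abs_nonneg x).trans hx
  induction k with
  | zero =>
    rw [hermiteFun_zero, hermiteFun_one, hermiteBound]
    have := sq_le_sq' (abs_le.1 hx).1 (abs_le.1 hx).2
    linarith
  | succ k ih =>
    rw [hermiteBound]
    refine le_trans ?_ (mul_le_mul_of_nonneg_left ih (by positivity))
    have p2 : 0 < Real.sqrt ((k : ℝ) + 2) := by positivity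
    set s := Real.sqrt ((k : ℝ) + 2)
    set c := Real.sqrt ((k : ℝ) + 1) / s
    have hc0 : 0 ≤ c := by positivity
    have hc1 : c ≤ 1 := by
      rw [div_le_one p2]
      exact Real.sqrt_le_sqrt (by linarith)
    have hrec : hermiteFun (k + 2) x = x / s * hermiteFun (k + 1) x - c * hermiteFun k x := by
      have := sqrt_mul_hermiteFun_succ k x
      simp only [c]
      field_simp
      linarith
    rw [show k + 1 + 1 = k + 2 from rfl, hrec]
    set u := hermiteFun (k + 1) x
    set v := hermiteFun k x
    have hδ : |x / s| ≤ R / s := by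
      rw [abs_div, abs_of_pos p2]
      gcongr
    set δ := x / s
    set Δ := R / s
    have hΔ : 0 ≤ Δ := (abs_nonneg _).trans hδ
    have h1 : δ ^ 2 ≤ Δ ^ 2 := sq_le_sq' (abs_le.1 hδ).1 (abs_le.1 hδ).2
    have h2 : -(2 * (δ * c) * (u * v)) ≤ Δ * (u ^ 2 + v ^ 2) := by
      have h3 : |δ * c| ≤ Δ := by
        rw [abs_mul, abs_of_nonneg hc0]
        nlinarith [abs_nonneg δ]
      have h4 : |2 * (u * v)| ≤ u ^ 2 + v ^ 2 :=
        abs_le.2 ⟨by nlinarith [sq_nonneg (u + v)], by nlinarith [sq_nonneg (u - v)]⟩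
      calc -(2 * (δ * c) * (u * v)) = -((δ * c) * (2 * (u * v))) := by ring
        _ ≤ |(δ * c) * (2 * (u * v))| := neg_le_abs _
        _ = |δ * c| * |2 * (u * v)| := abs_mul _ _
        _ ≤ Δ * (u ^ 2 + v ^ 2) := by gcongr
    have h5 : c ^ 2 * v ^ 2 ≤ v ^ 2 := by
      have : c ^ 2 ≤ 1 := pow_le_one₀ hc0 hc1
      nlinarith [sq_nonneg v]
    nlinarith [sq_nonneg u, sq_nonneg v, mul_le_mul_of_nonneg_right h1 (sq_nonneg u),
      mul_nonneg (sq_nonneg Δ) (sq_nonneg v)]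

theorem hermiteFun_sq_le {R x : ℝ} (hx : |x| ≤ R) (k : ℕ) :
    hermiteFun k x ^ 2 ≤ hermiteBound R k :=
  le_trans (by nlinarith [sq_nonneg (hermiteFun (k + 1) x)]) (hermiteFun_sq_add_sq_le hx k)

/-- Successive ratios of the majorant tend to 1, so those of the terms tend to ω. -/
theorem summable_pow_mul_hermiteBound {R ω : ℝ} (hR : 0 ≤ R) (hω0 : 0 < ω) (hω1 : ω < 1) :
    Summable fun k => ω ^ k * hermiteBound R k := by
  refine summable_of_ratio_test_tendsto_lt_one hω1
    (Eventually.of_forall fun k => (mul_pos (pow_pos hω0 k) (hermiteBound_pos hR k)).ne') ?_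
  have h1 : Tendsto (fun k : ℕ => R / Real.sqrt ((k : ℝ) + 2)) atTop (𝓝 0) := by
    refine Tendsto.div_atTop tendsto_const_nhds ?_
    exact Real.tendsto_sqrt_atTop.comp
      (tendsto_atTop_add_const_right _ _ tendsto_natCast_atTop_atTop)
  have h2 := ((h1.const_add 1).add (h1.pow 2)).const_mul ω
  simp only [add_zero, ne_eq, OfNat.ofNat_ne_zero, not_false_eq_true, zero_pow, mul_one] at h2
  refine h2.congr fun k => ?_
  have hb := hermiteBound_pos hR k
  have hb' := hermiteBound_pos hR (k + 1)
  rw [Real.norm_of_nonneg (by positivity), Real.norm_of_nonneg (by positivity), hermiteBound]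
  field_simp
  ring

end

section

/-! ### Multivariate Hermite polynomials and completeness -/

instance isProbabilityMeasure_gaussianMeasure (d : ℕ) :
    IsProbabilityMeasure (gaussianMeasure d) := by
  unfold gaussianMeasure; infer_instance

/-- Full support later turns almost everywhere equality of continuous functions into equality. -/
instance isOpenPosMeasure_gaussianReal : (gaussianReal 0 1).IsOpenPosMeasure :=
  (gaussianReal_absolutelyContinuous' 0 one_ne_zero).isOpenPosMeasure

instance isOpenPosMeasure_gaussianMeasure (d : ℕ) : (gaussianMeasure d).IsOpenPosMeasure := by
  unfold gaussianMeasure; infer_instance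

variable {d : ℕ}

theorem memLp_two_prod_gaussianMeasure {f : Fin d → ℝ → ℝ}
    (hf : ∀ j, MemLp (f j) 2 (gaussianReal 0 1)) :
    MemLp (fun x : Fin d → ℝ => ∏ j, f j (x j)) 2 (gaussianMeasure d) := by
  have hm : AEStronglyMeasurable (fun x : Fin d → ℝ => ∏ j, f j (x j)) (gaussianMeasure d) :=
    (Integrable.fintype_prod_dep fun j => (hf j).integrable one_le_two).aestronglyMeasurable
  rw [memLp_two_iff_integrable_sq hm]
  simp_rw [← Finset.prod_pow]
  exact Integrable.fintype_prod_dep (f := fun j x => f j x ^ 2) fun j => (hf j).integrable_sq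

theorem memLp_hermiteMulti (k : Fin d → ℕ) : MemLp (hermiteMulti k) 2 (gaussianMeasure d) :=
  memLp_two_prod_gaussianMeasure fun j => by exact_mod_cast memLp_hermiteFun (k j) 2

theorem continuous_hermiteMulti (k : Fin d → ℕ) : Continuous (hermiteMulti k) :=
  continuous_finsetProd _ fun j _ => (continuous_hermiteFun (k j)).comp (continuous_apply j)

theorem hermiteMulti_zero (x : Fin d → ℝ) : hermiteMulti 0 x = 1 := by
  simp [hermiteMulti, hermiteFun_zero]

theorem integral_hermiteMulti_mul (k l : Fin d → ℕ) :
    ∫ x, hermiteMulti k x * hermiteMulti l x ∂(gaussianMeasure d) = if k = l then 1 else 0 := by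
  simp_rw [hermiteMulti, ← Finset.prod_mul_distrib]
  rw [gaussianMeasure, integral_fintype_prod_eq_prod
    (f := fun j x => hermiteFun (k j) x * hermiteFun (l j) x)]
  simp_rw [integral_hermiteFun_mul]
  by_cases h : k = l
  · simp [h]
  · obtain ⟨j, hj⟩ := Function.ne_iff.1 h
    rw [if_neg h]
    exact Finset.prod_eq_zero (Finset.mem_univ j) (if_neg hj)

theorem integral_hermiteMulti_sq (k : Fin d → ℕ) :
    ∫ x, hermiteMulti k x ^ 2 ∂(gaussianMeasure d) = 1 := by
  simp_rw [pow_two, integral_hermiteMulti_mul, if_pos]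

theorem integral_hermiteMulti {k : Fin d → ℕ} (hk : k ≠ 0) :
    ∫ x, hermiteMulti k x ∂(gaussianMeasure d) = 0 := by
  simpa [hermiteMulti_zero, hk] using integral_hermiteMulti_mul k 0

theorem hermiteMulti_update (k : Fin d → ℕ) (j : Fin d) (m : ℕ) (x : Fin d → ℝ) :
    hermiteMulti (Function.update k j m) x
      = hermiteFun m (x j) * ∏ i ∈ Finset.univ.erase j, hermiteFun (k i) (x i) := by
  rw [hermiteMulti, ← Finset.mul_prod_erase _ _ (Finset.mem_univ j), Function.update_self]
  congr 1
  refine Finset.prod_congr rfl fun i hi => ?_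
  rw [Function.update_of_ne (Finset.ne_of_mem_erase hi)]

/-- The recurrence solved for x H_k. At k = 0 the truncated index k - 1 is harmless, since its
coefficient vanishes. -/
theorem mul_hermiteFun (k : ℕ) (x : ℝ) : x * hermiteFun k x =
    Real.sqrt ((k : ℝ) + 1) * hermiteFun (k + 1) x
      + Real.sqrt (k : ℝ) * hermiteFun (k - 1) x := by
  cases k with
  | zero => simp [hermiteFun_zero, hermiteFun_one]
  | succ k =>
    have := sqrt_mul_hermiteFun_succ k x
    push_cast
    rw [add_assoc (k : ℝ), one_add_one_eq_two, this, sub_add_cancel]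

/-- The linear span of the Hermite polynomials, which is the space of polynomial functions. -/
noncomputable def hermiteSpan (d : ℕ) : Submodule ℝ ((Fin d → ℝ) → ℝ) :=
  Submodule.span ℝ (Set.range hermiteMulti)

theorem coord_mul_mem_hermiteSpan (j : Fin d) {w : (Fin d → ℝ) → ℝ} (hw : w ∈ hermiteSpan d) :
    (fun x => x j * w x) ∈ hermiteSpan d := by
  induction hw using Submodule.span_induction with
  | mem w hw =>
    obtain ⟨k, rfl⟩ := hw
    have h : (fun x => x j * hermiteMulti k x)
        = Real.sqrt ((k j : ℝ) + 1) • hermiteMulti (Function.update k j (k j + 1))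
          + Real.sqrt (k j : ℝ) • hermiteMulti (Function.update k j (k j - 1)) := by
      ext x
      have h1 := hermiteMulti_update k j (k j) x
      rw [Function.update_eq_self] at h1
      simp only [Pi.add_apply, Pi.smul_apply, smul_eq_mul, hermiteMulti_update]
      rw [h1, ← mul_assoc, mul_hermiteFun]
      ring
    rw [h]
    exact add_mem (Submodule.smul_mem _ _ (Submodule.subset_span ⟨_, rfl⟩))
      (Submodule.smul_mem _ _ (Submodule.subset_span ⟨_, rfl⟩))
  | zero =>
    simp only [Pi.zero_apply, mul_zero]
    exact Submodule.zero_mem (hermiteSpan d)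
  | add v w _ _ hv hw =>
    have h : (fun x => x j * (v + w) x) = (fun x => x j * v x) + fun x => x j * w x := by
      ext x; simp [mul_add]
    rw [h]
    exact add_mem hv hw
  | smul a w _ hw =>
    have h : (fun x => x j * (a • w) x) = a • fun x => x j * w x := by
      ext x; simp; ring
    rw [h]
    exact Submodule.smul_mem _ _ hw

/-- The span is stable under multiplication by coordinates. These powers are, up to constants, the
Taylor terms of exp(iL), through which completeness is reduced to Fourier uniqueness. -/
theorem dual_pow_mem_hermiteSpan (L : StrongDual ℝ (Fin d → ℝ)) (n : ℕ) :
    (fun x => L x ^ n) ∈ hermiteSpan d := by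
  induction n with
  | zero =>
    have : (fun x => L x ^ 0) = hermiteMulti (0 : Fin d → ℕ) := by
      ext x; simp [hermiteMulti_zero]
    rw [this]
    exact Submodule.subset_span ⟨_, rfl⟩
  | succ n ih =>
    have h : (fun x => L x ^ (n + 1))
        = ∑ j, L (Pi.single j 1) • fun x : Fin d → ℝ => x j * L x ^ n := by
      ext x
      have hx : L x = ∑ j, L (Pi.single j 1) * x j := by
        conv_lhs => rw [pi_eq_sum_univ' x]
        rw [map_sum]
        refine Finset.sum_congr rfl fun j _ => ?_
        rw [map_smul, smul_eq_mul, mul_comm]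
      rw [pow_succ', Finset.sum_apply]
      nth_rewrite 1 [hx]
      rw [Finset.sum_mul]
      refine Finset.sum_congr rfl fun j _ => ?_
      simp [mul_assoc]
    rw [h]
    exact Submodule.sum_mem _ fun j _ =>
      Submodule.smul_mem _ _ (coord_mul_mem_hermiteSpan j ih)

/-! ### Completeness by uniqueness of characteristic functions -/

theorem integrable_exp_mul_norm_gaussianMeasure (c : ℝ) :
    Integrable (fun x : Fin d → ℝ => Real.exp (c * ‖x‖)) (gaussianMeasure d) := by
  have h1 : Integrable (fun x : ℝ => Real.exp (|c| * |x|)) (gaussianReal 0 1) := by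
    refine ((integrable_exp_mul_gaussianReal (μ := 0) (v := 1) |c|).add
      (integrable_exp_mul_gaussianReal (μ := 0) (v := 1) (-|c|))).mono' (by fun_prop)
      (ae_of_all _ fun x => ?_)
    rw [Real.norm_of_nonneg (Real.exp_pos _).le, Pi.add_apply]
    rcases abs_cases x with ⟨h, -⟩ | ⟨h, -⟩
    · rw [h]; linarith [Real.exp_pos (-|c| * x)]
    · rw [h, mul_neg, ← neg_mul]; linarith [Real.exp_pos (|c| * x)]
  have h2 : Integrable (fun x : Fin d → ℝ => ∏ j, Real.exp (|c| * |x j|)) (gaussianMeasure d) :=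
    Integrable.fintype_prod_dep (f := fun _ x => Real.exp (|c| * |x|)) fun _ => h1
  refine h2.mono' (by fun_prop) (ae_of_all _ fun x => ?_)
  rw [Real.norm_of_nonneg (Real.exp_pos _).le, ← Real.exp_sum, ← Finset.mul_sum]
  refine Real.exp_le_exp.2 ?_
  refine (mul_le_mul_of_nonneg_right (le_abs_self c) (norm_nonneg x)).trans ?_
  refine mul_le_mul_of_nonneg_left ?_ (abs_nonneg c)
  refine (pi_norm_le_iff_of_nonneg (Finset.sum_nonneg fun j _ => abs_nonneg _)).2 fun j => ?_
  exact Finset.single_le_sum (f := fun j => |x j|) (fun j _ => abs_nonneg _) (Finset.mem_univ j)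

theorem memLp_exp_abs_dual (L : StrongDual ℝ (Fin d → ℝ)) :
    MemLp (fun x => Real.exp |L x|) 2 (gaussianMeasure d) := by
  rw [memLp_two_iff_integrable_sq (by fun_prop)]
  refine (integrable_exp_mul_norm_gaussianMeasure (2 * ‖L‖)).mono' (by fun_prop)
    (ae_of_all _ fun x => ?_)
  rw [Real.norm_of_nonneg (by positivity), ← Real.exp_nat_mul]
  refine Real.exp_le_exp.2 ?_
  have := L.le_opNorm x
  rw [Real.norm_eq_abs] at this
  push_cast
  linarith

theorem memLp_of_mem_hermiteSpan {w : (Fin d → ℝ) → ℝ} (hw : w ∈ hermiteSpan d) :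
    MemLp w 2 (gaussianMeasure d) := by
  induction hw using Submodule.span_induction with
  | mem w hw => obtain ⟨k, rfl⟩ := hw; exact memLp_hermiteMulti k
  | zero => exact MemLp.zero
  | add v w _ _ hv hw => exact hv.add hw
  | smul a w _ hw => exact hw.const_smul a

theorem integral_mul_eq_zero_of_hermiteCoeff {f : (Fin d → ℝ) → ℝ}
    (hf : MemLp f 2 (gaussianMeasure d)) (h0 : ∀ k, hermiteCoeff f k = 0)
    {w : (Fin d → ℝ) → ℝ} (hw : w ∈ hermiteSpan d) :
    ∫ x, f x * w x ∂(gaussianMeasure d) = 0 := by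
  induction hw using Submodule.span_induction with
  | mem w hw => obtain ⟨k, rfl⟩ := hw; exact h0 k
  | zero => simp
  | add v w hv' hw' hv hw =>
    simp_rw [Pi.add_apply, mul_add]
    have h1 := integral_add (hf.integrable_mul (memLp_of_mem_hermiteSpan hv'))
      (hf.integrable_mul (memLp_of_mem_hermiteSpan hw'))
    simp only [Pi.mul_apply] at h1
    rw [h1, hv, hw, add_zero]
  | smul a w _ hw =>
    simp_rw [Pi.smul_apply, smul_eq_mul, mul_left_comm _ a]
    rw [integral_const_mul, hw, mul_zero]

/-- Expand the exponential: f is orthogonal to every Taylor term, and termwise integration is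
justified by the majorant |f| exp|L|, a product of two square-integrable functions. -/
theorem integral_mul_cexp_eq_zero_of_hermiteCoeff {f : (Fin d → ℝ) → ℝ}
    (hf : MemLp f 2 (gaussianMeasure d)) (h0 : ∀ k, hermiteCoeff f k = 0)
    (L : StrongDual ℝ (Fin d → ℝ)) :
    ∫ x, (f x : ℂ) * Complex.exp (L x * Complex.I) ∂(gaussianMeasure d) = 0 := by
  have hm := hf.aestronglyMeasurable
  have hsum : ∀ x, HasSum (fun n : ℕ => |f x| * (|L x| ^ n / n.factorial))
      (|f x| * Real.exp |L x|) := fun x => by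
    rw [Real.exp_eq_exp_ℝ]
    exact (NormedSpace.expSeries_div_hasSum_exp |L x|).mul_left _
  have key := hasSum_integral_of_dominated_convergence (μ := gaussianMeasure d)
    (F := fun (n : ℕ) x => (f x : ℂ) * ((L x * Complex.I) ^ n / n.factorial))
    (f := fun x => (f x : ℂ) * Complex.exp (L x * Complex.I))
    (fun n x => |f x| * (|L x| ^ n / n.factorial))
    (fun n => (Complex.continuous_ofReal.comp_aestronglyMeasurable hm).mul
      (Continuous.aestronglyMeasurable (by fun_prop)))
    (fun n => ae_of_all _ fun x => by simp)
    (ae_of_all _ fun x => (hsum x).summable)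
    (by
      simp_rw [fun x => (hsum x).tsum_eq]
      exact hf.norm.integrable_mul (memLp_exp_abs_dual L))
    (ae_of_all _ fun x => by
      rw [Complex.exp_eq_exp_ℂ]
      exact (NormedSpace.expSeries_div_hasSum_exp (L x * Complex.I)).mul_left _)
  have hz : ∀ n : ℕ, ∫ x, (f x : ℂ) * ((L x * Complex.I) ^ n / n.factorial)
      ∂(gaussianMeasure d) = 0 := by
    intro n
    have h1 := integral_mul_eq_zero_of_hermiteCoeff hf h0 (dual_pow_mem_hermiteSpan L n)
    have h2 : ∀ x, (f x : ℂ) * ((L x * Complex.I) ^ n / n.factorial)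
        = ((f x * L x ^ n : ℝ) : ℂ) * (Complex.I ^ n / n.factorial) := by
      intro x; push_cast; ring
    simp_rw [h2]
    rw [integral_mul_const, integral_complex_ofReal, h1]
    simp
  simp_rw [hz] at key
  exact key.unique hasSum_zero

/-- Completeness of the Hermite polynomials in the Gaussian `L²` space. -/
theorem ae_eq_zero_of_hermiteCoeff {f : (Fin d → ℝ) → ℝ}
    (hf : MemLp f 2 (gaussianMeasure d)) (h0 : ∀ k, hermiteCoeff f k = 0) :
    f =ᵐ[gaussianMeasure d] 0 := by
  have hint : Integrable f (gaussianMeasure d) := hf.integrable one_le_two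
  have hm : AEMeasurable f (gaussianMeasure d) := hf.aestronglyMeasurable.aemeasurable
  -- Since `ENNReal.ofReal` truncates at 0, these two finite measures have densities f⁺ and f⁻.
  -- Their characteristic functions differ by the Fourier transform of f, which is zero, so the
  -- measures agree and f⁺ = f⁻ almost everywhere.
  have hfin1 : IsFiniteMeasure ((gaussianMeasure d).withDensity fun x => ENNReal.ofReal (f x)) :=
    isFiniteMeasure_withDensity_ofReal hint.2
  have hfin2 : IsFiniteMeasure
      ((gaussianMeasure d).withDensity fun x => ENNReal.ofReal (-f x)) :=
    isFiniteMeasure_withDensity_ofReal hint.neg.2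
  have hw : ∀ g : (Fin d → ℝ) → ℝ, AEMeasurable g (gaussianMeasure d) →
      ∀ L : StrongDual ℝ (Fin d → ℝ),
      charFunDual ((gaussianMeasure d).withDensity fun x => ENNReal.ofReal (g x)) L
        = ∫ x, ((max (g x) 0 : ℝ) : ℂ) * Complex.exp (L x * Complex.I)
          ∂(gaussianMeasure d) := by
    intro g hg L
    rw [charFunDual_apply, integral_withDensity_eq_integral_toReal_smul₀ hg.ennreal_ofReal
      (ae_of_all _ fun _ => ENNReal.ofReal_lt_top)]
    refine integral_congr_ae (ae_of_all _ fun x => ?_)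
    simp [ENNReal.toReal_ofReal']
  have hi : ∀ g : (Fin d → ℝ) → ℝ, Integrable g (gaussianMeasure d) →
      ∀ L : StrongDual ℝ (Fin d → ℝ),
      Integrable (fun x => ((max (g x) 0 : ℝ) : ℂ) * Complex.exp (L x * Complex.I))
        (gaussianMeasure d) := by
    intro g hg L
    refine hg.pos_part.ofReal.mul_bdd (c := 1) (Continuous.aestronglyMeasurable (by fun_prop))
      (ae_of_all _ fun x => ?_)
    rw [Complex.norm_exp_ofReal_mul_I]
  have heq : ((gaussianMeasure d).withDensity fun x => ENNReal.ofReal (f x))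
      = (gaussianMeasure d).withDensity fun x => ENNReal.ofReal (-f x) := by
    refine Measure.ext_of_charFunDual ?_
    ext L
    rw [hw f hm, hw (fun x => -f x) hm.neg, ← sub_eq_zero, ← integral_sub (hi f hint L) (hi (fun x => -f x) hint.neg L),
      ← integral_mul_cexp_eq_zero_of_hermiteCoeff hf h0 L]
    refine integral_congr_ae (ae_of_all _ fun x => ?_)
    simp only
    rw [← sub_mul, ← Complex.ofReal_sub]
    congr 2
    rcases le_total (f x) 0 with h | h
    · rw [max_eq_right h, max_eq_left (by linarith)]; ring
    · rw [max_eq_left h, max_eq_right (by linarith)]; ring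
  rw [withDensity_eq_iff hm.ennreal_ofReal (AEMeasurable.ennreal_ofReal (f := fun x => -f x) hm.neg)] at heq
  · filter_upwards [heq] with x hx
    rcases le_total (f x) 0 with h | h
    · rw [ENNReal.ofReal_of_nonpos h, eq_comm, ENNReal.ofReal_eq_zero] at hx
      simp only [Pi.zero_apply]
      linarith
    · rw [ENNReal.ofReal_of_nonpos (p := -f x) (by simpa using h), ENNReal.ofReal_eq_zero] at hx
      exact le_antisymm hx h
  · exact hint.lintegral_lt_top.ne

end

section

/-! ### Sums over multi-indices and weighted Cauchy–Schwarz -/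

theorem hasSum_prod_of_nonneg {d : ℕ} {a : Fin d → ℕ → ℝ} (ha : ∀ j n, 0 ≤ a j n)
    (hs : ∀ j, Summable (a j)) :
    HasSum (fun k : Fin d → ℕ => ∏ j, a j (k j)) (∏ j, ∑' n, a j n) := by
  induction d with
  | zero => simp
  | succ d ih =>
    have h1 := ih (a := fun j => a j.succ) (fun j => ha _) (fun j => hs _)
    have h0 := (hs 0).hasSum
    have hsum := h0.summable.mul_of_nonneg h1.summable (ha 0)
      (fun k => Finset.prod_nonneg fun j _ => ha _ _)
    have h3 := HasSum.mul h0 h1 hsum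
    let e : ℕ × (Fin d → ℕ) ≃ (Fin (d + 1) → ℕ) := Fin.consEquiv fun _ => ℕ
    have h2 : (fun k : Fin (d + 1) → ℕ => ∏ j, a j (k j)) ∘ e
        = fun x => a 0 x.1 * ∏ j, a j.succ (x.2 j) := by
      ext x
      simp [e, Fin.prod_univ_succ, Fin.consEquiv]
    rw [← e.hasSum_iff, Fin.prod_univ_succ, h2]
    exact h3

theorem summable_abs_mul_of_weighted {ι : Type*} {r a b : ι → ℝ} (hr : ∀ k, 0 < r k)
    (ha : Summable fun k => (r k)⁻¹ * |a k| ^ 2) (hb : Summable fun k => r k * b k ^ 2) :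
    Summable fun k => |a k * b k| := by
  refine Summable.of_nonneg_of_le (fun _ => abs_nonneg _) (fun k => ?_) (ha.add hb)
  have h := hr k
  have h1 : (Real.sqrt (r k)) ^ 2 = r k := Real.sq_sqrt h.le
  have h2 : 0 < Real.sqrt (r k) := Real.sqrt_pos.2 h
  rw [abs_mul, ← h1, ← sq_abs (b k)]
  have h3 : (Real.sqrt (r k) ^ 2)⁻¹ * |a k| ^ 2 + Real.sqrt (r k) ^ 2 * |b k| ^ 2
      - |a k| * |b k| = ((Real.sqrt (r k))⁻¹ * |a k| - Real.sqrt (r k) * |b k|) ^ 2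
        + |a k| * |b k| := by
    field_simp
    ring
  nlinarith [sq_nonneg ((Real.sqrt (r k))⁻¹ * |a k| - Real.sqrt (r k) * |b k|),
    mul_nonneg (abs_nonneg (a k)) (abs_nonneg (b k))]

/-- Cauchy–Schwarz on finite subsets, passed to the limit. -/
theorem sq_tsum_mul_le_of_weighted {ι : Type*} {r a b : ι → ℝ} (hr : ∀ k, 0 < r k)
    (ha : Summable fun k => (r k)⁻¹ * |a k| ^ 2) (hb : Summable fun k => r k * b k ^ 2) :
    (∑' k, a k * b k) ^ 2 ≤ (∑' k, (r k)⁻¹ * |a k| ^ 2) * ∑' k, r k * b k ^ 2 := by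
  have hs := (summable_abs_mul_of_weighted hr ha hb).of_abs.hasSum
  refine le_of_tendsto (hs.pow 2) (Eventually.of_forall fun s => ?_)
  refine (Finset.sum_sq_le_sum_mul_sum_of_sq_le_mul s (f := fun k => (r k)⁻¹ * |a k| ^ 2)
    (g := fun k => r k * b k ^ 2) (fun k _ => ?_) (fun k _ => ?_) fun k _ => ?_).trans ?_
  · have := hr k; positivity
  · have := hr k; positivity
  · have := (hr k).ne'
    rw [sq_abs]
    field_simp
    exact le_rfl
  · have h1 : ∀ k, 0 ≤ (r k)⁻¹ * |a k| ^ 2 := fun k => by have := hr k; positivity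
    have h2 : ∀ k, 0 ≤ r k * b k ^ 2 := fun k => by have := hr k; positivity
    exact mul_le_mul (ha.sum_le_tsum s fun k _ => h1 k) (hb.sum_le_tsum s fun k _ => h2 k)
      (Finset.sum_nonneg fun k _ => h2 k) (tsum_nonneg h1)

/-! ### Pointwise Hermite expansions -/

variable {d : ℕ}

theorem hermiteNorm_rpow_two (r : (Fin d → ℕ) → ℝ) (f : (Fin d → ℝ) → ℝ) :
    hermiteNorm r f ^ (2 : ℝ)
      = ∑' k : Fin d → ℕ, ENNReal.ofReal ((r k)⁻¹ * |hermiteCoeff f k| ^ 2) := by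
  rw [hermiteNorm, ← ENNReal.rpow_mul]
  norm_num

theorem summable_of_hermiteNorm_lt_top {r : (Fin d → ℕ) → ℝ} (hr : ∀ k, 0 < r k)
    {f : (Fin d → ℝ) → ℝ} (hf : hermiteNorm r f < ∞) :
    Summable fun k => (r k)⁻¹ * |hermiteCoeff f k| ^ 2 := by
  have h : hermiteNorm r f ^ (2 : ℝ) ≠ ∞ := ENNReal.rpow_ne_top_of_nonneg (by norm_num) hf.ne
  rw [hermiteNorm_rpow_two] at h
  refine (ENNReal.summable_toReal h).congr fun k => ?_
  have := hr k
  rw [ENNReal.toReal_ofReal (by positivity)]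

theorem tsum_le_one_of_hermiteNorm_le_one {r : (Fin d → ℕ) → ℝ} (hr : ∀ k, 0 < r k)
    {f : (Fin d → ℝ) → ℝ} (hf : hermiteNorm r f ≤ 1) :
    ∑' k, (r k)⁻¹ * |hermiteCoeff f k| ^ 2 ≤ 1 := by
  have hs := summable_of_hermiteNorm_lt_top hr (hf.trans_lt ENNReal.one_lt_top)
  have h : hermiteNorm r f ^ (2 : ℝ) ≤ 1 := by
    simpa using ENNReal.rpow_le_rpow hf (by norm_num : (0 : ℝ) ≤ 2)
  rw [hermiteNorm_rpow_two, ← ENNReal.ofReal_tsum_of_nonneg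
    (fun k => by have := hr k; positivity) hs, ENNReal.ofReal_le_one] at h
  exact h

/-- The Hermite expansions with weights `r` converge locally uniformly. -/
def LocallyDominated (r : (Fin d → ℕ) → ℝ) : Prop :=
  ∀ R : ℝ, ∃ B : (Fin d → ℕ) → ℝ, (∀ x : Fin d → ℝ, ‖x‖ ≤ R → ∀ k, hermiteMulti k x ^ 2 ≤ B k) ∧
    Summable fun k => r k * B k

theorem LocallyDominated.summable {r : (Fin d → ℕ) → ℝ} (h : LocallyDominated r)
    (hr : ∀ k, 0 < r k) (x : Fin d → ℝ) : Summable fun k => r k * hermiteMulti k x ^ 2 := by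
  obtain ⟨B, hB, hs⟩ := h ‖x‖
  refine Summable.of_nonneg_of_le (fun k => ?_) (fun k => ?_) hs
  · have := hr k; positivity
  · exact mul_le_mul_of_nonneg_left (hB x le_rfl k) (hr k).le

/-- On a ball around each point the terms are dominated by |a k| √(B k), which is summable by the
weighted inequality; the Weierstrass test applies. -/
theorem continuous_tsum_hermite {r : (Fin d → ℕ) → ℝ} (hr : ∀ k, 0 < r k)
    (hloc : LocallyDominated r) {a : (Fin d → ℕ) → ℝ}
    (ha : Summable fun k => (r k)⁻¹ * |a k| ^ 2) :
    Continuous fun x => ∑' k, a k * hermiteMulti k x := by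
  refine continuous_iff_continuousAt.2 fun x => ?_
  obtain ⟨B, hB, hs⟩ := hloc (‖x‖ + 1)
  have hB0 : ∀ k, 0 ≤ B k := fun k => (sq_nonneg _).trans (hB x (by linarith) k)
  have hs' : Summable fun k => r k * Real.sqrt (B k) ^ 2 :=
    hs.congr fun k => by rw [Real.sq_sqrt (hB0 k)]
  have hc : ContinuousOn (fun y => ∑' k, a k * hermiteMulti k y)
      (Metric.ball (0 : Fin d → ℝ) (‖x‖ + 1)) := by
    refine continuousOn_tsum (fun k => (continuous_const.mul
      (continuous_hermiteMulti k)).continuousOn) (summable_abs_mul_of_weighted hr ha hs')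
      fun k y hy => ?_
    rw [norm_mul, abs_mul, Real.norm_eq_abs, Real.norm_eq_abs, abs_of_nonneg (Real.sqrt_nonneg _)]
    refine mul_le_mul_of_nonneg_left (Real.abs_le_sqrt (hB y ?_ k)) (abs_nonneg _)
    exact (mem_ball_zero_iff.1 hy).le
  exact hc.continuousAt (Metric.isOpen_ball.mem_nhds (by simp))

/-- By Cauchy–Schwarz the square is at most A ∑ r(k) H_k², whose integral is A ∑ r(k) by
normalization. -/
theorem memLp_tsum_hermite {r : (Fin d → ℕ) → ℝ} (hr : ∀ k, 0 < r k) (hrs : Summable r)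
    (hloc : LocallyDominated r) {a : (Fin d → ℕ) → ℝ}
    (ha : Summable fun k => (r k)⁻¹ * |a k| ^ 2) :
    MemLp (fun x => ∑' k, a k * hermiteMulti k x) 2 (gaussianMeasure d) := by
  have hm := (continuous_tsum_hermite hr hloc ha).aestronglyMeasurable (μ := gaussianMeasure d)
  rw [memLp_two_iff_integrable_sq hm]
  have hH : ∀ k, Integrable (fun x => hermiteMulti k x ^ 2) (gaussianMeasure d) :=
    fun k => (memLp_hermiteMulti k).integrable_sq
  set A := ∑' k, (r k)⁻¹ * |a k| ^ 2
  have hA : 0 ≤ A := tsum_nonneg fun k => by have := hr k; positivity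
  have hnn : ∀ k (x : Fin d → ℝ), 0 ≤ A * (r k * hermiteMulti k x ^ 2) := fun k x => by
    have := hr k; positivity
  refine (lintegral_ofReal_ne_top_iff_integrable (hm.pow 2) (ae_of_all _ fun x => sq_nonneg _)).1 ?_
  have hK : ∫⁻ x, ∑' k, ENNReal.ofReal (A * (r k * hermiteMulti k x ^ 2)) ∂(gaussianMeasure d)
      ≠ ∞ := by
    rw [lintegral_tsum fun k => (by
      have := continuous_hermiteMulti k
      fun_prop)]
    simp_rw [fun k => (ofReal_integral_eq_lintegral_ofReal (((hH k).const_mul (r k)).const_mul A)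
      (ae_of_all _ (hnn k))).symm, integral_const_mul, integral_hermiteMulti_sq, mul_one]
    exact (hrs.mul_left A).tsum_ofReal_ne_top
  refine ne_top_of_le_ne_top hK (lintegral_mono fun x => ?_)
  have hx := hloc.summable hr x
  rw [← ENNReal.ofReal_tsum_of_nonneg (fun k => hnn k x) (hx.mul_left A), tsum_mul_left]
  exact ENNReal.ofReal_le_ofReal (sq_tsum_mul_le_of_weighted hr ha hx)

theorem hermiteCoeff_tsum_hermite {r : (Fin d → ℕ) → ℝ} (hr : ∀ k, 0 < r k) (hrs : Summable r)
    {a : (Fin d → ℕ) → ℝ} (ha : Summable fun k => (r k)⁻¹ * |a k| ^ 2) (m : Fin d → ℕ) :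
    hermiteCoeff (fun x => ∑' k, a k * hermiteMulti k x) m = a m := by
  have habs : Summable fun k => |a k| := by
    simpa using summable_abs_mul_of_weighted hr ha (b := fun _ => 1) (by simpa using hrs)
  have hi : ∀ k, Integrable (fun x => hermiteMulti k x * hermiteMulti m x) (gaussianMeasure d) :=
    fun k => (memLp_hermiteMulti k).integrable_mul (memLp_hermiteMulti m)
  -- Any bound uniform in k permits termwise integration, as the a k are absolutely summable; |uv| ≤
  -- u² + v² gives 2.
  have hle : ∀ k, ∫ x, |hermiteMulti k x * hermiteMulti m x| ∂(gaussianMeasure d) ≤ 2 := by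
    intro k
    have h1 := (memLp_hermiteMulti k).integrable_sq
    have h2 := (memLp_hermiteMulti m).integrable_sq
    calc ∫ x, |hermiteMulti k x * hermiteMulti m x| ∂(gaussianMeasure d)
        ≤ ∫ x, (hermiteMulti k x ^ 2 + hermiteMulti m x ^ 2) ∂(gaussianMeasure d) := by
          refine integral_mono (hi k).abs (h1.add h2) fun x => ?_
          simp only
          rw [abs_mul, ← sq_abs (hermiteMulti k x), ← sq_abs (hermiteMulti m x)]
          nlinarith [sq_nonneg (|hermiteMulti k x| - |hermiteMulti m x|),
            sq_nonneg (|hermiteMulti k x| + |hermiteMulti m x|)]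
      _ = 2 := by
          rw [integral_add h1 h2, integral_hermiteMulti_sq, integral_hermiteMulti_sq]
          norm_num
  have key := hasSum_integral_of_summable_integral_norm (μ := gaussianMeasure d)
    (F := fun k x => a k * (hermiteMulti k x * hermiteMulti m x))
    (fun k => (hi k).const_mul _) (by
      refine Summable.of_nonneg_of_le (fun k => integral_nonneg fun x => norm_nonneg _)
        (fun k => ?_) (habs.mul_right 2)
      simp_rw [Real.norm_eq_abs, abs_mul (a k)]
      rw [integral_const_mul]
      exact mul_le_mul_of_nonneg_left (hle k) (abs_nonneg _))
  have h3 : ∀ x, ∑' k, a k * (hermiteMulti k x * hermiteMulti m x)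
      = (∑' k, a k * hermiteMulti k x) * hermiteMulti m x := by
    intro x
    rw [← tsum_mul_right]
    simp_rw [mul_assoc]
  simp_rw [h3, integral_const_mul, integral_hermiteMulti_mul] at key
  refine key.unique ?_
  have h4 : (fun k => a k * if k = m then 1 else 0) = fun k => if k = m then a m else 0 := by
    ext k
    split_ifs with h <;> simp [h]
  rw [h4]
  exact hasSum_ite_eq m (a m)

/-- Functions in a Hermite space are the pointwise sums of their Hermite series. -/
theorem hasSum_hermite {r : (Fin d → ℕ) → ℝ} (hr : ∀ k, 0 < r k) (hrs : Summable r)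
    (hloc : LocallyDominated r) {f : (Fin d → ℝ) → ℝ} (hf : f ∈ hermiteSpace r)
    (x : Fin d → ℝ) : HasSum (fun k => hermiteCoeff f k * hermiteMulti k x) (f x) := by
  obtain ⟨hc, hL, hn⟩ := hf
  have ha := summable_of_hermiteNorm_lt_top hr hn
  have hgL := memLp_tsum_hermite hr hrs hloc ha
  have hgc := continuous_tsum_hermite hr hloc ha
  -- The difference of f and its series has no Hermite coefficients, so it vanishes almost
  -- everywhere, hence everywhere by continuity and full support.
  have h0 : ∀ m, hermiteCoeff
      (f - fun x => ∑' k, hermiteCoeff f k * hermiteMulti k x) m = 0 := by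
    intro m
    have h1 := integral_sub (hL.integrable_mul (memLp_hermiteMulti m))
      (hgL.integrable_mul (memLp_hermiteMulti m))
    have h2 := hermiteCoeff_tsum_hermite hr hrs ha m
    simp only [Pi.mul_apply] at h1
    rw [hermiteCoeff] at h2 ⊢
    simp_rw [Pi.sub_apply, sub_mul]
    rw [h1, h2, hermiteCoeff, sub_self]
  have hae := ae_eq_zero_of_hermiteCoeff (hL.sub hgL) h0
  have heq := Continuous.ae_eq_iff_eq (gaussianMeasure d) (hc.sub hgc) continuous_zero |>.1 hae
  have hx := congrFun heq x
  rw [Pi.zero_apply, Pi.sub_apply, sub_eq_zero] at hx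
  rw [hx]
  exact (summable_abs_mul_of_weighted hr ha (hloc.summable hr x)).of_abs.hasSum

theorem gaussianIntegral_eq_hermiteCoeff (f : (Fin d → ℝ) → ℝ) :
    gaussianIntegral f = hermiteCoeff f 0 := by
  simp [gaussianIntegral, hermiteCoeff, hermiteMulti_zero]

/-! ### The exponential weights -/

theorem expWeight_pos {ω γ : ℝ} (hω : 0 < ω) (hγ : 0 < γ) (k : ℕ) : 0 < expWeight ω γ k := by
  unfold expWeight; split_ifs <;> positivity

theorem expWeight_le_pow {ω γ : ℝ} (hω : 0 < ω) (hγ : γ ≤ 1) (k : ℕ) :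
    expWeight ω γ k ≤ ω ^ k := by
  unfold expWeight
  split_ifs with h
  · simp [h]
  · exact mul_le_of_le_one_left (by positivity) hγ

theorem summable_expWeight {ω γ : ℝ} (hω : ω ∈ Set.Ioo (0 : ℝ) 1) (hγ : γ ∈ Set.Ioo (0 : ℝ) 1) :
    Summable (expWeight ω γ) :=
  Summable.of_nonneg_of_le (fun k => (expWeight_pos hω.1 hγ.1 k).le)
    (fun k => expWeight_le_pow hω.1 hγ.2.le k) (summable_geometric_of_lt_one hω.1.le hω.2)

theorem tsum_expWeight {ω γ : ℝ} (hω : ω ∈ Set.Ioo (0 : ℝ) 1) (hγ : γ ∈ Set.Ioo (0 : ℝ) 1) :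
    ∑' k, expWeight ω γ k = 1 + γ * (ω / (1 - ω)) := by
  rw [(summable_expWeight hω hγ).tsum_eq_zero_add]
  have h : ∀ k : ℕ, expWeight ω γ (k + 1) = γ * ω * ω ^ k := fun k => by
    simp [expWeight, pow_succ]; ring
  simp_rw [h]
  rw [tsum_mul_left, tsum_geometric_of_lt_one hω.1.le hω.2]
  simp [expWeight]
  ring

variable {ω γ : ℕ → ℝ}

theorem expWeightMulti_pos (hω : ∀ j, ω j ∈ Set.Ioo (0 : ℝ) 1)
    (hγ : ∀ j, γ j ∈ Set.Ioo (0 : ℝ) 1) (k : Fin d → ℕ) : 0 < expWeightMulti ω γ d k :=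
  Finset.prod_pos fun j _ => expWeight_pos (hω j).1 (hγ j).1 _

theorem hasSum_expWeightMulti (hω : ∀ j, ω j ∈ Set.Ioo (0 : ℝ) 1)
    (hγ : ∀ j, γ j ∈ Set.Ioo (0 : ℝ) 1) :
    HasSum (expWeightMulti ω γ d)
    (∏ j : Fin d, (1 + γ j * (ω j / (1 - ω j)))) := by
  have h := hasSum_prod_of_nonneg (d := d) (a := fun j => expWeight (ω j) (γ j))
    (fun j n => (expWeight_pos (hω j).1 (hγ j).1 n).le) fun j => summable_expWeight (hω j) (hγ j)
  simp_rw [fun j : Fin d => tsum_expWeight (hω j) (hγ j)] at h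
  exact h

theorem locallyDominated_expWeightMulti (hω : ∀ j, ω j ∈ Set.Ioo (0 : ℝ) 1)
    (hγ : ∀ j, γ j ∈ Set.Ioo (0 : ℝ) 1) :
    LocallyDominated (expWeightMulti ω γ d) := by
  intro R
  -- `max R 0` because R is arbitrary, while positivity of the majorant needs a nonnegative radius.
  refine ⟨fun k => ∏ j, hermiteBound (max R 0) (k j), fun x hx k => ?_, ?_⟩
  · rw [hermiteMulti, ← Finset.prod_pow]
    refine Finset.prod_le_prod (fun j _ => sq_nonneg _) fun j _ => hermiteFun_sq_le ?_ _
    exact ((norm_le_pi_norm x j).trans hx).trans (le_max_left _ _)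
  · have hb : ∀ n, 0 < hermiteBound (max R 0) n := hermiteBound_pos (le_max_right _ _)
    have h := hasSum_prod_of_nonneg (d := d)
      (a := fun j n => ω j ^ n * hermiteBound (max R 0) n)
      (fun j n => (mul_pos (pow_pos (hω j).1 n) (hb n)).le)
      (fun j => summable_pow_mul_hermiteBound (le_max_right _ _) (hω j).1 (hω j).2)
    refine Summable.of_nonneg_of_le (fun k => ?_) (fun k => ?_) h.summable
    · exact mul_nonneg (expWeightMulti_pos hω hγ k).le (Finset.prod_nonneg fun j _ => (hb _).le)
    · rw [expWeightMulti, ← Finset.prod_mul_distrib]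
      refine Finset.prod_le_prod (fun j _ => mul_nonneg (expWeight_pos (hω j).1 (hγ j).1 _).le
        (hb _).le) fun j _ => ?_
      exact mul_le_mul_of_nonneg_right (expWeight_le_pow (hω j).1 (hγ j).2.le _) (hb _).le

end

section

/-! ### Upper bound for the information complexity -/

theorem abs_hermiteCoeff_zero_le {d : ℕ} {r : (Fin d → ℕ) → ℝ} (hr : ∀ k, 0 < r k)
    (hr0 : r 0 = 1) {f : (Fin d → ℝ) → ℝ} (hf : hermiteNorm r f ≤ 1) :
    |hermiteCoeff f 0| ≤ 1 := by
  have hs := summable_of_hermiteNorm_lt_top hr (hf.trans_lt ENNReal.one_lt_top)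
  have h := (hs.le_tsum 0 fun k _ => by have := hr k; positivity).trans
    (tsum_le_one_of_hermiteNorm_le_one hr hf)
  simp only [hr0, inv_one, one_mul] at h
  exact (sq_le_one_iff₀ (abs_nonneg _)).1 h

/-- I(f) is the zeroth coefficient, which enters the norm with weight 1; the constant function 1
attains the bound. -/
theorem initialError_eq_one {d : ℕ} {r : (Fin d → ℕ) → ℝ} (hr : ∀ k, 0 < r k)
    (hr0 : r 0 = 1) : initialError r = 1 := by
  refine le_antisymm (iSup₂_le fun f hf => ?_) ?_
  · rw [gaussianIntegral_eq_hermiteCoeff]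
    exact ENNReal.ofReal_le_one.2 (abs_hermiteCoeff_zero_le hr hr0 hf.2)
  · have hc : ∀ k : Fin d → ℕ, hermiteCoeff (fun _ => 1) k = if k = 0 then 1 else 0 := by
      intro k
      have := integral_hermiteMulti_mul (d := d) 0 k
      simp only [hermiteMulti_zero] at this
      rw [hermiteCoeff, this]
      simp [eq_comm]
    have hn : hermiteNorm r (fun _ => 1) = 1 := by
      rw [hermiteNorm, tsum_eq_single 0]
      · simp [hc, hr0]
      · intro k hk
        simp [hc, hk]
    refine le_trans ?_ (le_iSup₂ (f := fun f (_ : f ∈ {f | f ∈ hermiteSpace r ∧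
      hermiteNorm r f ≤ 1}) => ENNReal.ofReal |gaussianIntegral f|) (fun _ => 1)
      ⟨⟨continuous_const, memLp_const 1, ?_⟩, hn.le⟩)
    · simp [gaussianIntegral_eq_hermiteCoeff, hc]
    · rw [hn]; exact ENNReal.one_lt_top

/-- The integration error of the Hermite polynomial `H_k`. -/
noncomputable def hermiteError {d n : ℕ} (P : Fin n → Fin d → ℝ) (k : Fin d → ℕ) : ℝ :=
  gaussianIntegral (hermiteMulti k) - qmcRule P (hermiteMulti k)

theorem gaussianIntegral_hermiteMulti {d : ℕ} (k : Fin d → ℕ) :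
    gaussianIntegral (hermiteMulti k) = if k = 0 then 1 else 0 := by
  have := integral_hermiteMulti_mul k 0
  simp only [hermiteMulti_zero, mul_one] at this
  exact this

/-- The pointwise expansion makes the error of f the pairing of its coefficients with the errors of
the H_k; Cauchy–Schwarz with the weights r finishes. -/
theorem worstCaseError_le {d n : ℕ} {r : (Fin d → ℕ) → ℝ} (hr : ∀ k, 0 < r k)
    (hrs : Summable r) (hloc : LocallyDominated r) (P : Fin n → Fin d → ℝ) {C : ℝ}
    (hC : 0 ≤ C)
    (hP : ∑' k, ENNReal.ofReal (r k * hermiteError P k ^ 2) ≤ ENNReal.ofReal (C ^ 2)) :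
    worstCaseError r P ≤ ENNReal.ofReal C := by
  have hnn : ∀ k, 0 ≤ r k * hermiteError P k ^ 2 := fun k => by have := hr k; positivity
  have hb : Summable fun k => r k * hermiteError P k ^ 2 := by
    refine (ENNReal.summable_toReal (ne_top_of_le_ne_top ENNReal.ofReal_ne_top hP)).congr
      fun k => ?_
    rw [ENNReal.toReal_ofReal (hnn k)]
  rw [← ENNReal.ofReal_tsum_of_nonneg hnn hb, ENNReal.ofReal_le_ofReal_iff (sq_nonneg _)] at hP
  refine iSup₂_le fun f hf => ENNReal.ofReal_le_ofReal ?_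
  have ha := summable_of_hermiteNorm_lt_top hr hf.1.2.2
  have ha1 := tsum_le_one_of_hermiteNorm_le_one hr hf.2
  have hI : HasSum (fun k => hermiteCoeff f k * gaussianIntegral (hermiteMulti k))
      (gaussianIntegral f) := by
    have h1 : (fun k => hermiteCoeff f k * gaussianIntegral (hermiteMulti k))
        = fun k => if k = 0 then hermiteCoeff f 0 else 0 := by
      ext k
      rw [gaussianIntegral_hermiteMulti]
      split_ifs with h <;> simp [h]
    rw [h1, gaussianIntegral_eq_hermiteCoeff]
    exact hasSum_ite_eq 0 _
  have hQ : HasSum (fun k => hermiteCoeff f k * qmcRule P (hermiteMulti k)) (qmcRule P f) := by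
    have h1 := (hasSum_sum (s := Finset.univ) fun i (_ : i ∈ Finset.univ) =>
      hasSum_hermite hr hrs hloc hf.1 (P i)).mul_left (1 / (n : ℝ))
    have h2 : (fun k => hermiteCoeff f k * qmcRule P (hermiteMulti k))
        = fun k => 1 / (n : ℝ) * ∑ i, hermiteCoeff f k * hermiteMulti k (P i) := by
      ext k
      rw [qmcRule, ← Finset.mul_sum]
      ring
    rw [h2]
    exact h1
  have hE : HasSum (fun k => hermiteCoeff f k * hermiteError P k)
      (gaussianIntegral f - qmcRule P f) := by
    simpa only [hermiteError, mul_sub] using hI.sub hQ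
  refine abs_le_of_sq_le_sq ?_ hC
  rw [← hE.tsum_eq]
  refine (sq_tsum_mul_le_of_weighted hr ha hb).trans ?_
  exact (mul_le_mul ha1 hP (tsum_nonneg hnn) zero_le_one).trans_eq (one_mul _)

/-- Up to sign the error is the mean of n independent copies of a centred variable of variance 1. -/
theorem lintegral_hermiteError_sq {d n : ℕ} (hn : 1 ≤ n) {k : Fin d → ℕ} (hk : k ≠ 0) :
    ∫⁻ P, ENNReal.ofReal (hermiteError P k ^ 2)
      ∂(Measure.pi fun _ : Fin n => gaussianMeasure d) = ENNReal.ofReal (1 / n) := by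
  set ν := Measure.pi fun _ : Fin n => gaussianMeasure d
  have hn0 : (n : ℝ) ≠ 0 := by positivity
  set X : (Fin n → Fin d → ℝ) → ℝ := ∑ i, fun P => hermiteMulti k (P i)
  have hmem : ∀ i : Fin n, MemLp (fun P : Fin n → Fin d → ℝ => hermiteMulti k (P i)) 2 ν :=
    fun i => (memLp_hermiteMulti k).comp_measurePreserving (measurePreserving_eval _ i)
  have hX : MemLp X 2 ν := memLp_finsetSum' _ fun i _ => hmem i
  have hX0 : ∫ P, X P ∂ν = 0 := by
    simp only [X, Finset.sum_apply]
    rw [integral_finsetSum _ fun i _ => (hmem i).integrable one_le_two]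
    refine Finset.sum_eq_zero fun i _ => ?_
    have h := (measurePreserving_eval (fun _ : Fin n => gaussianMeasure d) i)
    have h2 := integral_map (μ := ν) h.measurable.aemeasurable
      (f := hermiteMulti k) (continuous_hermiteMulti k).aestronglyMeasurable
    rw [h.map_eq, integral_hermiteMulti hk] at h2
    exact h2.symm
  have hvar1 : Var[hermiteMulti k; gaussianMeasure d] = 1 := by
    rw [variance_of_integral_eq_zero (continuous_hermiteMulti k).aemeasurable
      (integral_hermiteMulti hk)]
    exact integral_hermiteMulti_sq k
  have hvar := variance_sum_pi (μ := fun _ : Fin n => gaussianMeasure d)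
    (X := fun _ => hermiteMulti k) fun _ => memLp_hermiteMulti k
  rw [variance_of_integral_eq_zero hX.aestronglyMeasurable.aemeasurable hX0] at hvar
  simp only [hvar1, Finset.sum_const, Finset.card_univ, Fintype.card_fin, nsmul_eq_mul,
    mul_one] at hvar
  have he : ∀ P : Fin n → Fin d → ℝ, hermiteError P k ^ 2 = (1 / (n : ℝ)) ^ 2 * X P ^ 2 := by
    intro P
    rw [hermiteError, gaussianIntegral_hermiteMulti, if_neg hk, qmcRule]
    simp only [X, Finset.sum_apply]
    ring
  simp_rw [he]
  rw [← ofReal_integral_eq_lintegral_ofReal (hX.integrable_sq.const_mul _)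
    (ae_of_all _ fun P => by positivity), integral_const_mul]
  congr 1
  rw [show ∫ P, X P ^ 2 ∂ν = n from hvar]
  field_simp

theorem hermiteError_zero {d n : ℕ} (hn : 1 ≤ n) (P : Fin n → Fin d → ℝ) :
    hermiteError P 0 = 0 := by
  have hn0 : (n : ℝ) ≠ 0 := by positivity
  simp [hermiteError, gaussianIntegral_hermiteMulti, qmcRule, hermiteMulti_zero, hn0]

/-- Some point set does no worse than the average over independent Gaussian points. Constants are
integrated exactly, so k = 0 drops out and S - 1 remains. -/
theorem exists_points_tsum_hermiteError_le {d n : ℕ} (hn : 1 ≤ n) {r : (Fin d → ℕ) → ℝ}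
    (hr : ∀ k, 0 < r k) (hr0 : r 0 = 1) {S : ℝ} (hS : HasSum r S) :
    ∃ P : Fin n → Fin d → ℝ,
      ∑' k, ENNReal.ofReal (r k * hermiteError P k ^ 2) ≤ ENNReal.ofReal ((S - 1) / n) := by
  have hcont : ∀ k, Continuous fun P : Fin n → Fin d → ℝ => hermiteError P k := by
    intro k
    have := continuous_hermiteMulti k
    unfold hermiteError qmcRule
    fun_prop
  have hmeas : ∀ k, Measurable fun P : Fin n → Fin d → ℝ =>
      ENNReal.ofReal (r k * hermiteError P k ^ 2) := fun k => by
    have := hcont k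
    exact (Continuous.measurable (by fun_prop)).ennreal_ofReal
  obtain ⟨P, hP⟩ := exists_le_lintegral (μ := Measure.pi fun _ : Fin n => gaussianMeasure d)
    (f := fun P => ∑' k, ENNReal.ofReal (r k * hermiteError P k ^ 2))
    (Measurable.tsum hmeas).aemeasurable
  refine ⟨P, hP.trans ?_⟩
  rw [lintegral_tsum fun k => (hmeas k).aemeasurable]
  have hterm : ∀ k, ∫⁻ P, ENNReal.ofReal (r k * hermiteError P k ^ 2)
      ∂(Measure.pi fun _ : Fin n => gaussianMeasure d)
      = ENNReal.ofReal ((if k = 0 then 0 else r k) * (1 / n)) := by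
    intro k
    split_ifs with hk
    · simp [hk, hermiteError_zero hn]
    · simp_rw [ENNReal.ofReal_mul (hr k).le]
      rw [lintegral_const_mul _ (by have := hcont k; exact (Continuous.measurable
        (by fun_prop)).ennreal_ofReal), lintegral_hermiteError_sq hn hk]
  simp_rw [hterm]
  have hS' : HasSum (fun k => (if k = 0 then 0 else r k) * (1 / (n : ℝ))) ((S - 1) / n) := by
    have h1 := (hS.sub (hasSum_ite_eq (0 : Fin d → ℕ) (1 : ℝ))).mul_right (1 / (n : ℝ))
    rw [mul_one_div] at h1
    have h2 : (fun k => (if k = 0 then 0 else r k) * (1 / (n : ℝ)))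
        = fun k => (r k - if k = 0 then 1 else 0) * (1 / (n : ℝ)) := by
      ext k
      split_ifs with h <;> simp [h, hr0]
    rw [h2]
    exact h1
  rw [← ENNReal.ofReal_tsum_of_nonneg (fun k => ?_) hS'.summable, hS'.tsum_eq]
  split_ifs with h
  · simp
  · have := hr k; positivity

theorem nMin_le {d : ℕ} {r : (Fin d → ℕ) → ℝ} (hr : ∀ k, 0 < r k) (hr0 : r 0 = 1)
    (hloc : LocallyDominated r) {S : ℝ} (hS : HasSum r S) {ε : ℝ} (hε0 : 0 < ε) (hε1 : ε < 1) :
    ((nMin r ε : ℕ∞) : ℝ≥0∞) ≤ ENNReal.ofReal (S * ε ^ (-2 : ℝ)) := by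
  have hS1 : 1 ≤ S := hr0 ▸ (hS.tsum_eq ▸ hS.summable.le_tsum 0 fun k _ => (hr k).le)
  have hpow : ε ^ (-2 : ℝ) = (ε ^ 2)⁻¹ := by
    rw [Real.rpow_neg hε0.le]; norm_num
  have hinv : 1 ≤ (ε ^ 2)⁻¹ := (one_le_inv₀ (by positivity)).2 (pow_le_one₀ hε0.le hε1.le)
  rw [hpow]
  -- Having S - 1 instead of S leaves room ε⁻² ≥ 1, which absorbs the rounding up.
  set n := max 1 ⌈(S - 1) * (ε ^ 2)⁻¹⌉₊
  have hn1 : 1 ≤ n := le_max_left _ _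
  have hnS : (S - 1) * (ε ^ 2)⁻¹ ≤ n := (Nat.le_ceil _).trans (by exact_mod_cast le_max_right _ _)
  have hnle : (n : ℝ) ≤ S * (ε ^ 2)⁻¹ := by
    have h0 : 0 ≤ (S - 1) * (ε ^ 2)⁻¹ := mul_nonneg (by linarith) (by positivity)
    simp only [n, Nat.cast_max, Nat.cast_one]
    refine max_le (by nlinarith) ?_
    have := (Nat.ceil_lt_add_one h0).le
    nlinarith
  have hmem : n ∈ {n : ℕ | 1 ≤ n ∧ ∃ P : Fin n → (Fin d → ℝ),
      worstCaseError r P ≤ ENNReal.ofReal ε * initialError r} := by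
    obtain ⟨P, hP⟩ := exists_points_tsum_hermiteError_le hn1 hr hr0 hS
    refine ⟨hn1, P, ?_⟩
    rw [initialError_eq_one hr hr0, mul_one]
    refine worstCaseError_le hr hS.summable hloc P hε0.le (hP.trans (ENNReal.ofReal_le_ofReal ?_))
    rw [div_le_iff₀ (by positivity)]
    have := mul_le_mul_of_nonneg_left hnS (sq_nonneg ε)
    calc S - 1 = ε ^ 2 * ((S - 1) * (ε ^ 2)⁻¹) := by field_simp
      _ ≤ _ := this
  have h1 : nMin r ε ≤ n := iInf₂_le n hmem
  calc ((nMin r ε : ℕ∞) : ℝ≥0∞) ≤ ((n : ℕ∞) : ℝ≥0∞) := by exact_mod_cast h1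
    _ = ENNReal.ofReal n := by simp
    _ ≤ _ := ENNReal.ofReal_le_ofReal hnle

end

section

/-! ### Lower bound for the information complexity -/

/-- A function with finite Hermite expansion. -/
noncomputable def hermiteFinsum (m : ℕ) (c : ℕ → ℝ) (x : ℝ) : ℝ :=
  ∑ k ∈ Finset.range m, c k * hermiteFun k x

theorem continuous_hermiteFinsum (m : ℕ) (c : ℕ → ℝ) : Continuous (hermiteFinsum m c) :=
  continuous_finsetSum _ fun k _ => continuous_const.mul (continuous_hermiteFun k)

theorem memLp_hermiteFinsum (m : ℕ) (c : ℕ → ℝ) :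
    MemLp (hermiteFinsum m c) 2 (gaussianReal 0 1) :=
  memLp_finsetSum _ fun k _ => MemLp.const_mul (by exact_mod_cast memLp_hermiteFun k 2) _

theorem integral_hermiteFinsum_mul (m : ℕ) (c : ℕ → ℝ) (l : ℕ) :
    ∫ x, hermiteFinsum m c x * hermiteFun l x ∂(gaussianReal 0 1)
      = if l < m then c l else 0 := by
  have h2 : ∀ k, MemLp (hermiteFun k) 2 (gaussianReal 0 1) :=
    fun k => by exact_mod_cast memLp_hermiteFun k 2
  simp_rw [hermiteFinsum, Finset.sum_mul, mul_assoc]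
  rw [integral_finsetSum (f := fun k x => c k * (hermiteFun k x * hermiteFun l x)) _
    fun k _ => ((h2 k).integrable_mul (h2 l)).const_mul _]
  simp_rw [integral_const_mul, integral_hermiteFun_mul]
  simp

theorem hermiteFun_two (x : ℝ) : hermiteFun 2 x = (x ^ 2 - 1) / Real.sqrt 2 := by
  rw [hermiteFun_eq, hermiteReal_succ, hermiteReal_succ, hermiteReal_zero]
  simp [Nat.factorial]
  ring

theorem hermiteFun_four (x : ℝ) :
    hermiteFun 4 x = (x ^ 4 - 6 * x ^ 2 + 3) / Real.sqrt 24 := by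
  rw [hermiteFun_eq]
  simp [hermiteReal_succ, hermiteReal_zero, Nat.factorial]
  ring

/-- For every point `y` there is a polynomial of degree at most `4` which has mean zero, is bounded
from below and is bounded away from zero at `y`. -/
theorem exists_hermiteFinsum_bump (y : ℝ) : ∃ c : ℕ → ℝ, c 0 = 0 ∧
    (∑ k ∈ Finset.range 5, c k ^ 2 ≤ 26) ∧
    (∀ x, -5 ≤ hermiteFinsum 5 c x) ∧ 1 / 4 ≤ hermiteFinsum 5 c y := by
  have s2 : Real.sqrt 2 ^ 2 = 2 := Real.sq_sqrt (by norm_num)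
  have s24 : Real.sqrt 24 ^ 2 = 24 := Real.sq_sqrt (by norm_num)
  have e2 : ∀ x, Real.sqrt 2 * hermiteFun 2 x = x ^ 2 - 1 := fun x => by
    rw [hermiteFun_two, mul_div_cancel₀ _ (by positivity)]
  have e4 : ∀ x, Real.sqrt 24 * hermiteFun 4 x = x ^ 4 - 6 * x ^ 2 + 3 := fun x => by
    rw [hermiteFun_four, mul_div_cancel₀ _ (by positivity)]
  -- For |y| ≥ 1/2, with s the sign of y, use x² + 2sx - 1 = √2 H_2 + 2s H_1: its minimum is -2 and
  -- its value at y is at least 1/4.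
  have hquad : ∀ s x : ℝ,
      hermiteFinsum 5 (fun k => if k = 1 then 2 * s else if k = 2 then Real.sqrt 2 else 0) x
        = x ^ 2 + 2 * s * x - 1 := fun s x => by
    simp only [hermiteFinsum, Finset.sum_range_succ, Finset.sum_range_zero]
    norm_num [e2, hermiteFun_one]
    ring
  have hsq : ∀ s : ℝ, s ^ 2 = 1 → ∑ k ∈ Finset.range 5,
      (if k = 1 then 2 * s else if k = 2 then Real.sqrt 2 else 0) ^ 2 ≤ 26 := fun s hs => by
    simp only [Finset.sum_range_succ, Finset.sum_range_zero]
    norm_num [s2, mul_pow, hs]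
  rcases le_or_gt (1 / 2) y with hy | hy
  · refine ⟨_, ?_, hsq 1 (by norm_num), fun x => ?_, ?_⟩
    · norm_num
    · rw [hquad]; nlinarith [sq_nonneg (x + 1)]
    · rw [hquad]; nlinarith
  rcases le_or_gt y (-(1 / 2)) with hy' | hy'
  · refine ⟨_, ?_, hsq (-1) (by norm_num), fun x => ?_, ?_⟩
    · norm_num
    · rw [hquad]; nlinarith [sq_nonneg (x - 1)]
    · rw [hquad]; nlinarith
  -- For |y| < 1/2 use x⁴ - 5x² + 2 = √24 H_4 + √2 H_2: its minimum is -17/4 and its squared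
  -- coefficients sum to 26.
  have hquart : ∀ x : ℝ, hermiteFinsum 5
      (fun k => if k = 2 then Real.sqrt 2 else if k = 4 then Real.sqrt 24 else 0) x
        = x ^ 4 - 5 * x ^ 2 + 2 := fun x => by
    simp only [hermiteFinsum, Finset.sum_range_succ, Finset.sum_range_zero]
    norm_num [e2, e4]
    ring
  refine ⟨fun k => if k = 2 then Real.sqrt 2 else if k = 4 then Real.sqrt 24 else 0,
    ?_, ?_, fun x => ?_, ?_⟩
  · norm_num
  · simp only [Finset.sum_range_succ, Finset.sum_range_zero]
    norm_num [s2, s24]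
  · rw [hquart]; nlinarith [sq_nonneg (x ^ 2 - 5 / 2)]
  · have h : y ^ 2 ≤ 1 / 4 := by nlinarith
    rw [hquart]; nlinarith [sq_nonneg (y ^ 2)]

/-- A fooling function factor. -/
theorem exists_fooling_factor {a : ℝ} (ha0 : 0 < a) (ha1 : a < 1) {ω γ : ℝ} (hω : a ≤ ω)
    (hγ : γ ∈ Set.Ioo (0 : ℝ) 1) (y : ℝ) :
    ∃ c : ℕ → ℝ, c 0 = 1 ∧ (∀ x, 0 ≤ hermiteFinsum 5 c x) ∧
      1 + γ * (a ^ 4 / 416) ≤ hermiteFinsum 5 c y ∧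
      ∑ k ∈ Finset.range 5, (expWeight ω γ k)⁻¹ * c k ^ 2 ≤ 1 + γ * (a ^ 4 / 416) := by
  obtain ⟨c, hc0, hc, hlow, hy⟩ := exists_hermiteFinsum_bump y
  have hωpos : 0 < ω := ha0.trans_le hω
  obtain ⟨hγ0, hγ1⟩ := hγ
  have ha4 : a ^ 4 ≤ 1 := pow_le_one₀ ha0.le ha1.le
  -- The factor is 1 + γδ · bump. This δ equates the gain γδ/4 at y with the bound 26γδ²/a⁴ on the
  -- added squared norm, both being γa⁴/416; it is also below 1/5, which keeps the factor
  -- nonnegative.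
  set δ := a ^ 4 / 104
  have hδ0 : 0 < δ := by positivity
  have hδ1 : δ ≤ 1 / 104 := by simp only [δ]; linarith
  have hval : ∀ x, hermiteFinsum 5 (fun k => if k = 0 then 1 else γ * δ * c k) x
      = 1 + γ * δ * hermiteFinsum 5 c x := by
    intro x
    simp only [hermiteFinsum, Finset.sum_range_succ, Finset.sum_range_zero, hc0, hermiteFun_zero]
    norm_num
    ring
  refine ⟨fun k => if k = 0 then 1 else γ * δ * c k, if_pos rfl, fun x => ?_, ?_, ?_⟩
  · rw [hval]
    have h1 : γ * δ * (-5) ≤ γ * δ * hermiteFinsum 5 c x :=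
      mul_le_mul_of_nonneg_left (hlow x) (by positivity)
    have h2 : γ * δ ≤ 1 * (1 / 104) := mul_le_mul hγ1.le hδ1 hδ0.le zero_le_one
    linarith
  · rw [hval]
    have h1 : γ * δ * (1 / 4) ≤ γ * δ * hermiteFinsum 5 c y :=
      mul_le_mul_of_nonneg_left hy (by positivity)
    calc 1 + γ * (a ^ 4 / 416) = 1 + γ * δ * (1 / 4) := by simp only [δ]; ring
      _ ≤ _ := by linarith
  · have hterm : ∀ k ∈ Finset.range 5,
        (expWeight ω γ k)⁻¹ * (if k = 0 then 1 else γ * δ * c k) ^ 2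
          ≤ (if k = 0 then 1 else 0) + γ * δ ^ 2 * (a ^ 4)⁻¹ * c k ^ 2 := by
      intro k hk
      rw [expWeight]
      split_ifs with h
      · simp [h, hc0]
      · have hωk : a ^ 4 ≤ ω ^ k := by
          have hk4 : k ≤ 4 := by have := Finset.mem_range.1 hk; omega
          exact (pow_le_pow_of_le_one ha0.le ha1.le hk4).trans (pow_le_pow_left₀ ha0.le hω k)
        have e : (γ * ω ^ k)⁻¹ * (γ * δ * c k) ^ 2 = γ * δ ^ 2 * (ω ^ k)⁻¹ * c k ^ 2 := by
          field_simp
        rw [e, zero_add]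
        gcongr
    refine (Finset.sum_le_sum hterm).trans ?_
    rw [Finset.sum_add_distrib, ← Finset.mul_sum]
    have h2 : γ * δ ^ 2 * (a ^ 4)⁻¹ * ∑ k ∈ Finset.range 5, c k ^ 2
        ≤ γ * δ ^ 2 * (a ^ 4)⁻¹ * 26 := mul_le_mul_of_nonneg_left hc (by positivity)
    have h3 : γ * δ ^ 2 * (a ^ 4)⁻¹ * 26 = γ * (a ^ 4 / 416) := by
      simp only [δ]
      field_simp
      norm_num
    rw [h3] at h2
    simpa using h2

variable {d : ℕ}

theorem hermiteCoeff_prod (g : Fin d → ℝ → ℝ) (k : Fin d → ℕ) :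
    hermiteCoeff (fun x => ∏ j, g j (x j)) k
      = ∏ j, ∫ x, g j x * hermiteFun (k j) x ∂(gaussianReal 0 1) := by
  simp_rw [hermiteCoeff, hermiteMulti, ← Finset.prod_mul_distrib]
  rw [gaussianMeasure, integral_fintype_prod_eq_prod
    (f := fun j x => g j x * hermiteFun (k j) x)]

/-- A nonnegative function of norm at most one whose value at `y` is large. -/
theorem exists_fooling_function {ω γ : ℕ → ℝ} (hω : ∀ j, ω j ∈ Set.Ioo (0 : ℝ) 1)
    (hγ : ∀ j, γ j ∈ Set.Ioo (0 : ℝ) 1) {a : ℝ} (ha0 : 0 < a) (ha : ∀ j, a ≤ ω j)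
    (y : Fin d → ℝ) :
    ∃ f ∈ hermiteSpace (expWeightMulti ω γ d), hermiteNorm (expWeightMulti ω γ d) f ≤ 1 ∧
      (∀ x, 0 ≤ f x) ∧ Real.sqrt (∏ j : Fin d, (1 + γ j * (a ^ 4 / 416))) ≤ f y := by
  have ha1 : a < 1 := (ha 0).trans_lt (hω 0).2
  choose c hc0 hcnn hcy hcn using fun j : Fin d =>
    exists_fooling_factor ha0 ha1 (ha j) (hγ j) (y j)
  set M := ∏ j : Fin d, (1 + γ j * (a ^ 4 / 416))
  have hM : 0 < M := Finset.prod_pos fun j _ => by have := (hγ j).1; positivity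
  have hsM : 0 < Real.sqrt M := Real.sqrt_pos.2 hM
  set g : (Fin d → ℝ) → ℝ := fun x => ∏ j, hermiteFinsum 5 (c j) (x j)
  have hgc : Continuous g :=
    continuous_finsetProd _ fun j _ => (continuous_hermiteFinsum 5 _).comp (continuous_apply j)
  have hgL : MemLp g 2 (gaussianMeasure d) :=
    memLp_two_prod_gaussianMeasure fun j => memLp_hermiteFinsum 5 (c j)
  -- M bounds both g(y) from below and the squared norm of g from above, so normalizing leaves the
  -- value at least M/√M = √M.
  set f : (Fin d → ℝ) → ℝ := fun x => (Real.sqrt M)⁻¹ * g x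
  have hco : ∀ k, hermiteCoeff f k
      = (Real.sqrt M)⁻¹ * ∏ j, if k j < 5 then c j (k j) else 0 := by
    intro k
    have h := hermiteCoeff_prod (fun j => hermiteFinsum 5 (c j)) k
    simp_rw [integral_hermiteFinsum_mul] at h
    rw [← h]
    simp_rw [hermiteCoeff, f, mul_assoc]
    rw [integral_const_mul]
  have hprod := hasSum_prod_of_nonneg (d := d)
    (a := fun j n => (expWeight (ω j) (γ j) n)⁻¹ * (if n < 5 then c j n else 0) ^ 2)
    (fun j n => mul_nonneg (inv_nonneg.2 (expWeight_pos (hω j).1 (hγ j).1 n).le) (sq_nonneg _))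
    (fun j => summable_of_ne_finset_zero (s := Finset.range 5) fun n hn => by
      rw [if_neg (by simpa using hn)]; simp)
  have hfac : ∀ j : Fin d, ∑' n, (expWeight (ω j) (γ j) n)⁻¹ * (if n < 5 then c j n else 0) ^ 2
      ≤ 1 + γ j * (a ^ 4 / 416) := by
    intro j
    rw [tsum_eq_sum (s := Finset.range 5) fun n hn => by
      rw [if_neg (by simpa using hn)]; simp]
    refine le_trans (le_of_eq ?_) (hcn j)
    exact Finset.sum_congr rfl fun n hn => by rw [if_pos (Finset.mem_range.1 hn)]
  have hterm : ∀ k : Fin d → ℕ, (expWeightMulti ω γ d k)⁻¹ * |hermiteCoeff f k| ^ 2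
      = M⁻¹ * ∏ j : Fin d, (expWeight (ω j) (γ j) (k j))⁻¹ * (if k j < 5 then c j (k j) else 0) ^ 2 := by
    intro k
    rw [hco, sq_abs, mul_pow, inv_pow, Real.sq_sqrt hM.le, Finset.prod_mul_distrib,
      Finset.prod_pow, Finset.prod_inv_distrib, expWeightMulti]
    ring
  have hnorm : hermiteNorm (expWeightMulti ω γ d) f ≤ 1 := by
    have hsum := hprod.mul_left M⁻¹
    rw [hermiteNorm]
    simp_rw [hterm]
    rw [← ENNReal.ofReal_tsum_of_nonneg (fun k => ?_) hsum.summable, hsum.tsum_eq]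
    · refine (ENNReal.rpow_le_rpow (ENNReal.ofReal_le_one.2 ?_) (by norm_num)).trans
        (ENNReal.one_rpow _).le
      rw [inv_mul_le_iff₀ hM, mul_one]
      refine Finset.prod_le_prod (fun j _ => tsum_nonneg fun n => ?_) fun j _ => hfac j
      exact mul_nonneg (inv_nonneg.2 (expWeight_pos (hω j).1 (hγ j).1 n).le) (sq_nonneg _)
    · rw [← hterm]
      exact mul_nonneg (inv_nonneg.2 (expWeightMulti_pos hω hγ k).le) (by positivity)
  refine ⟨f, ⟨continuous_const.mul hgc, hgL.const_mul _, hnorm.trans_lt ENNReal.one_lt_top⟩,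
    hnorm, fun x => ?_, ?_⟩
  · exact mul_nonneg (by positivity) (Finset.prod_nonneg fun j _ => hcnn j _)
  · rw [le_inv_mul_iff₀ hsM, Real.mul_self_sqrt hM.le]
    exact Finset.prod_le_prod (fun j _ => by have := (hγ j).1; positivity) fun j _ => hcy j

/-- Fool the first node: as f ≥ 0 the other nodes can be dropped, so Q(f) ≥ √M/n, whereas Q(f) ≤
I(f) + 1/2 ≤ 3/2. -/
theorem le_nMin {ω γ : ℕ → ℝ} (hω : ∀ j, ω j ∈ Set.Ioo (0 : ℝ) 1)
    (hγ : ∀ j, γ j ∈ Set.Ioo (0 : ℝ) 1) {a : ℝ} (ha0 : 0 < a) (ha : ∀ j, a ≤ ω j) :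
    ENNReal.ofReal (2 / 3 * Real.sqrt (∏ j : Fin d, (1 + γ j * (a ^ 4 / 416))))
      ≤ ((nMin (expWeightMulti ω γ d) (1 / 2) : ℕ∞) : ℝ≥0∞) := by
  have hr := expWeightMulti_pos (d := d) hω hγ
  have hr0 : expWeightMulti ω γ d 0 = 1 := by simp [expWeightMulti, expWeight]
  set M := ∏ j : Fin d, (1 + γ j * (a ^ 4 / 416))
  have key : ((⌈2 / 3 * Real.sqrt M⌉₊ : ℕ) : ℕ∞) ≤ nMin (expWeightMulti ω γ d) (1 / 2) := by
    refine le_iInf₂ fun n hn => ?_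
    obtain ⟨hn1, P, hP⟩ := hn
    rw [initialError_eq_one hr hr0, mul_one] at hP
    refine Nat.cast_le.2 (Nat.ceil_le.2 ?_)
    let i0 : Fin n := ⟨0, hn1⟩
    obtain ⟨f, hf, hfn, hf0, hfy⟩ := exists_fooling_function hω hγ ha0 ha (P i0)
    have hle := (le_iSup₂ (f := fun f (_ : f ∈ {f | f ∈ hermiteSpace (expWeightMulti ω γ d) ∧
      hermiteNorm (expWeightMulti ω γ d) f ≤ 1}) =>
        ENNReal.ofReal |gaussianIntegral f - qmcRule P f|) f ⟨hf, hfn⟩).trans hP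
    rw [ENNReal.ofReal_le_ofReal_iff (by norm_num)] at hle
    have hI : gaussianIntegral f ≤ 1 := by
      rw [gaussianIntegral_eq_hermiteCoeff]
      exact (le_abs_self _).trans (abs_hermiteCoeff_zero_le hr hr0 hfn)
    have hQ : Real.sqrt M / n ≤ qmcRule P f := by
      rw [qmcRule, div_eq_inv_mul, ← one_div]
      refine mul_le_mul_of_nonneg_left (hfy.trans ?_) (by positivity)
      exact Finset.single_le_sum (f := fun i => f (P i)) (fun i _ => hf0 _) (Finset.mem_univ i0)
    have hQ2 : Real.sqrt M / n ≤ 3 / 2 := by linarith [(abs_le.1 hle).1]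
    have hn0 : (0 : ℝ) < n := by exact_mod_cast hn1
    rw [div_le_iff₀ hn0] at hQ2
    linarith
  calc ENNReal.ofReal (2 / 3 * Real.sqrt M)
      ≤ ENNReal.ofReal (⌈2 / 3 * Real.sqrt M⌉₊ : ℕ) := ENNReal.ofReal_le_ofReal (Nat.le_ceil _)
    _ = (((⌈2 / 3 * Real.sqrt M⌉₊ : ℕ) : ℕ∞) : ℝ≥0∞) := by simp
    _ ≤ _ := by exact_mod_cast key

end

section

/-! ### Tractability -/

/-- The limits control a tail, and the finitely many remaining terms lie strictly inside (0, 1). -/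
theorem exists_bounds_of_liminf_limsup {ω : ℕ → ℝ} (hω : ∀ j, ω j ∈ Set.Ioo (0 : ℝ) 1)
    (hinf : 0 < liminf ω atTop) (hsup : limsup ω atTop < 1) :
    ∃ a b : ℝ, 0 < a ∧ b < 1 ∧ ∀ j, a ≤ ω j ∧ ω j ≤ b := by
  obtain ⟨a₁, ha₁, ha₁'⟩ := exists_between hinf
  obtain ⟨b₁, hb₁, hb₁'⟩ := exists_between hsup
  have h1 := eventually_lt_of_lt_liminf ha₁'
    (isBoundedUnder_of ⟨0, fun j => (hω j).1.le⟩)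
  have h2 := eventually_lt_of_limsup_lt hb₁
    (isBoundedUnder_of ⟨1, fun j => (hω j).2.le⟩)
  obtain ⟨N, hN⟩ := eventually_atTop.1 (h1.and h2)
  have hfin : ∀ n : ℕ, ∃ a b : ℝ, 0 < a ∧ b < 1 ∧ ∀ j < n, a ≤ ω j ∧ ω j ≤ b := by
    intro n
    induction n with
    | zero => exact ⟨1, 0, one_pos, one_pos, fun j hj => absurd hj (Nat.not_lt_zero j)⟩
    | succ n ih =>
      obtain ⟨a, b, ha, hb, h⟩ := ih
      refine ⟨min a (ω n), max b (ω n), lt_min ha (hω n).1, max_lt hb (hω n).2, fun j hj => ?_⟩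
      rcases Nat.lt_succ_iff_lt_or_eq.1 hj with hj | rfl
      · exact ⟨(min_le_left _ _).trans (h j hj).1, (h j hj).2.trans (le_max_left _ _)⟩
      · exact ⟨min_le_right _ _, le_max_right _ _⟩
  obtain ⟨a, b, ha, hb, h⟩ := hfin N
  refine ⟨min a a₁, max b b₁, lt_min ha ha₁, max_lt hb hb₁', fun j => ?_⟩
  rcases lt_or_ge j N with hj | hj
  · exact ⟨(min_le_left _ _).trans (h j hj).1, (h j hj).2.trans (le_max_left _ _)⟩
  · exact ⟨(min_le_right _ _).trans (hN j hj).1.le, (hN j hj).2.le.trans (le_max_right _ _)⟩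

variable {ω γ : ℕ → ℝ}

/-- Monotonicity of t/(1 - t) and 1 + x ≤ eˣ, applied to each factor of the total weight. -/
theorem nMin_expWeightMulti_le (hω : ∀ j, ω j ∈ Set.Ioo (0 : ℝ) 1)
    (hγ : ∀ j, γ j ∈ Set.Ioo (0 : ℝ) 1) {b : ℝ} (hb1 : b < 1) (hb : ∀ j, ω j ≤ b) (d : ℕ)
    {ε : ℝ} (hε0 : 0 < ε) (hε1 : ε < 1) :
    ((nMin (expWeightMulti ω γ d) ε : ℕ∞) : ℝ≥0∞) ≤ ENNReal.ofReal
      (Real.exp (b / (1 - b) * ∑ j ∈ Finset.range d, γ j) * ε ^ (-2 : ℝ)) := by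
  refine (nMin_le (expWeightMulti_pos hω hγ) (by simp [expWeightMulti, expWeight])
    (locallyDominated_expWeightMulti hω hγ) (hasSum_expWeightMulti hω hγ) hε0 hε1).trans
    (ENNReal.ofReal_le_ofReal (mul_le_mul_of_nonneg_right ?_ (by positivity)))
  rw [← Fin.sum_univ_eq_sum_range γ d, Finset.mul_sum, Real.exp_sum]
  refine Finset.prod_le_prod (fun j _ => ?_) fun j _ => ?_
  · have h1 := (hγ j).1
    have h2 := (hω j).1
    have h3 : 0 < 1 - ω j := by linarith [(hω j).2]
    positivity
  · have h3 : 0 < 1 - ω j := by linarith [(hω j).2]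
    have h4 : ω j / (1 - ω j) ≤ b / (1 - b) := by
      rw [div_le_div_iff₀ h3 (by linarith)]
      nlinarith [hb j]
    have h5 := mul_le_mul_of_nonneg_left h4 (hγ j).1.le
    calc 1 + γ j * (ω j / (1 - ω j)) ≤ b / (1 - b) * γ j + 1 := by linarith
      _ ≤ _ := Real.add_one_le_exp _

/-- If the information complexity at `ε = 1 / 2` is at most `C d ^ q`, then the partial sums of the
weights grow at most like `log d`. -/
theorem exists_sum_le_of_nMin_le (hω : ∀ j, ω j ∈ Set.Ioo (0 : ℝ) 1)
    (hγ : ∀ j, γ j ∈ Set.Ioo (0 : ℝ) 1) {a : ℝ} (ha0 : 0 < a) (ha : ∀ j, a ≤ ω j) :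
    ∃ κ : ℝ, 0 < κ ∧ ∀ (d : ℕ) (B : ℝ),
      ((nMin (expWeightMulti ω γ d) (1 / 2) : ℕ∞) : ℝ≥0∞) ≤ ENNReal.ofReal B → 0 < B →
      κ * ∑ j ∈ Finset.range d, γ j ≤ 2 * Real.log (3 / 2 * B) := by
  have ha1 : a < 1 := (ha 0).trans_lt (hω 0).2
  have ha4 : a ^ 4 ≤ 1 := pow_le_one₀ ha0.le ha1.le
  set κ := a ^ 4 / 416
  have hκ0 : 0 < κ := by positivity
  have hκ1 : κ ≤ 1 := by simp only [κ]; linarith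
  -- The half comes from log(1 + u) ≥ u/(1 + u) ≥ u/2 for 0 ≤ u ≤ 1; the 2 on the other side undoes
  -- the square root of M.
  refine ⟨κ / 2, by positivity, fun d B hB hB0 => ?_⟩
  have h1 := (le_nMin (d := d) hω hγ ha0 ha).trans hB
  rw [ENNReal.ofReal_le_ofReal_iff hB0.le] at h1
  set M := ∏ j : Fin d, (1 + γ j * κ)
  have hfac : ∀ j : Fin d, 0 < 1 + γ j * κ := fun j => by have := (hγ j).1; positivity
  have hM : 0 < M := Finset.prod_pos fun j _ => hfac j
  have hlogM : κ / 2 * ∑ j ∈ Finset.range d, γ j ≤ Real.log M := by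
    rw [Real.log_prod fun j _ => (hfac j).ne', ← Fin.sum_univ_eq_sum_range γ d, Finset.mul_sum]
    refine Finset.sum_le_sum fun j _ => ?_
    obtain ⟨hg0, hg1⟩ := hγ j
    have hu0 : 0 < γ j * κ := by positivity
    have hu1 : γ j * κ ≤ 1 := mul_le_one₀ hg1.le hκ0.le hκ1
    have h2 := Real.one_sub_inv_le_log_of_pos (hfac j)
    refine le_trans ?_ h2
    have h3 : 1 - (1 + γ j * κ)⁻¹ = γ j * κ / (1 + γ j * κ) := by
      have := (hfac j).ne'
      field_simp
      ring
    rw [h3, le_div_iff₀ (hfac j)]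
    nlinarith
  have hsq : Real.sqrt M ≤ 3 / 2 * B := by linarith
  have hlog : Real.log M / 2 ≤ Real.log (3 / 2 * B) := by
    rw [← Real.log_sqrt hM.le]
    exact Real.log_le_log (Real.sqrt_pos.2 hM) hsq
  linarith

theorem summable_of_stronglyPolynomiallyTractable (hω : ∀ j, ω j ∈ Set.Ioo (0 : ℝ) 1)
    (hγ : ∀ j, γ j ∈ Set.Ioo (0 : ℝ) 1) {a : ℝ} (ha0 : 0 < a) (ha : ∀ j, a ≤ ω j)
    (h : StronglyPolynomiallyTractable (expWeightMulti ω γ)) : Summable γ := by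
  obtain ⟨c, p, hc, -, hb⟩ := h
  obtain ⟨κ, hκ, hsum⟩ := exists_sum_le_of_nMin_le hω hγ ha0 ha
  set B := c * (1 / 2 : ℝ) ^ (-p)
  have hB : 0 < B := by positivity
  refine summable_of_sum_range_le (c := 2 * Real.log (3 / 2 * B) / κ)
    (fun j => (hγ j).1.le) fun d => ?_
  -- The tractability bound starts at dimension 1, so d + 1 is used to cover d = 0.
  have hle : ∑ j ∈ Finset.range d, γ j ≤ ∑ j ∈ Finset.range (d + 1), γ j := by
    rw [Finset.sum_range_succ]; linarith [(hγ d).1]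
  have h1 := hb (d + 1) (by omega) (1 / 2) (by norm_num) (by norm_num)
  rw [Real.rpow_zero, mul_one] at h1
  have h2 := hsum (d + 1) B h1 hB
  rw [le_div_iff₀ hκ]
  nlinarith

theorem stronglyPolynomiallyTractable_of_summable (hω : ∀ j, ω j ∈ Set.Ioo (0 : ℝ) 1)
    (hγ : ∀ j, γ j ∈ Set.Ioo (0 : ℝ) 1) {b : ℝ} (hb1 : b < 1) (hb : ∀ j, ω j ≤ b)
    (h : Summable γ) : StronglyPolynomiallyTractable (expWeightMulti ω γ) := by
  have hb0 : 0 < b := (hω 0).1.trans_le (hb 0)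
  have hC : 0 ≤ b / (1 - b) := div_nonneg hb0.le (by linarith)
  refine ⟨Real.exp (b / (1 - b) * ∑' j, γ j), 2, Real.exp_pos _, two_pos,
    fun d _ ε hε0 hε1 => (nMin_expWeightMulti_le hω hγ hb1 hb d hε0 hε1).trans
      (ENNReal.ofReal_le_ofReal ?_)⟩
  rw [Real.rpow_zero, mul_one]
  refine mul_le_mul_of_nonneg_right (Real.exp_le_exp.2 (mul_le_mul_of_nonneg_left ?_ hC))
    (by positivity)
  exact h.sum_le_tsum _ fun j _ => (hγ j).1.le

theorem limsup_lt_top_of_polynomiallyTractable (hω : ∀ j, ω j ∈ Set.Ioo (0 : ℝ) 1)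
    (hγ : ∀ j, γ j ∈ Set.Ioo (0 : ℝ) 1) {a : ℝ} (ha0 : 0 < a) (ha : ∀ j, a ≤ ω j)
    (h : PolynomiallyTractable (expWeightMulti ω γ)) :
    limsup (fun d : ℕ => (((∑ j ∈ Finset.range d, γ j) / Real.log (d : ℝ) : ℝ) : EReal))
      atTop < ⊤ := by
  obtain ⟨c, p, q, hc, -, hq, hb⟩ := h
  obtain ⟨κ, hκ, hsum⟩ := exists_sum_le_of_nMin_le hω hγ ha0 ha
  set A := 3 / 2 * (c * (1 / 2 : ℝ) ^ (-p))
  have hA : 0 < A := by positivity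
  have hlim : ∀ᶠ d : ℕ in atTop, ((∑ j ∈ Finset.range d, γ j) / Real.log (d : ℝ) : ℝ)
      ≤ 2 * (|Real.log A| + q) / κ := by
    -- As 3 > e, log d ≥ 1 here, so the constant log A is absorbed into |log A| log d.
    filter_upwards [eventually_ge_atTop 3] with d hd
    have hd3 : (3 : ℝ) ≤ d := by exact_mod_cast hd
    have hlog : 1 ≤ Real.log d := by
      rw [Real.le_log_iff_exp_le (by linarith)]
      linarith [Real.exp_one_lt_d9]
    have h1 := hb d (by omega) (1 / 2) (by norm_num) (by norm_num)
    have hdq : (0 : ℝ) < (d : ℝ) ^ q := by positivity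
    have h2 := hsum d _ h1 (by positivity)
    have h3 : Real.log (3 / 2 * (c * (d : ℝ) ^ q * (1 / 2 : ℝ) ^ (-p)))
        = Real.log A + q * Real.log d := by
      rw [show 3 / 2 * (c * (d : ℝ) ^ q * (1 / 2 : ℝ) ^ (-p)) = A * (d : ℝ) ^ q by
        simp only [A]; ring, Real.log_mul hA.ne' hdq.ne', Real.log_rpow (by linarith)]
    rw [h3] at h2
    rw [div_le_div_iff₀ (by linarith) hκ]
    have h4 : Real.log A ≤ |Real.log A| * Real.log d :=
      (le_abs_self _).trans (le_mul_of_one_le_right (abs_nonneg _) hlog)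
    nlinarith
  refine lt_of_le_of_lt (limsup_le_of_le (h := hlim.mono fun d hd => EReal.coe_le_coe_iff.2 hd))
    (EReal.coe_lt_top _)

theorem polynomiallyTractable_of_limsup_lt_top (hω : ∀ j, ω j ∈ Set.Ioo (0 : ℝ) 1)
    (hγ : ∀ j, γ j ∈ Set.Ioo (0 : ℝ) 1) {b : ℝ} (hb1 : b < 1) (hb : ∀ j, ω j ≤ b)
    (h : limsup (fun d : ℕ => (((∑ j ∈ Finset.range d, γ j) / Real.log (d : ℝ) : ℝ) : EReal))
      atTop < ⊤) : PolynomiallyTractable (expWeightMulti ω γ) := by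
  have hb0 : 0 < b := (hω 0).1.trans_le (hb 0)
  have hC : 0 ≤ b / (1 - b) := div_nonneg hb0.le (by linarith)
  obtain ⟨A, hA, -⟩ := EReal.lt_iff_exists_real_btwn.1 h
  obtain ⟨N, hN⟩ := eventually_atTop.1 (eventually_lt_of_limsup_lt hA)
  have hmono : ∀ m n : ℕ, m ≤ n → ∑ j ∈ Finset.range m, γ j ≤ ∑ j ∈ Finset.range n, γ j :=
    fun m n hmn => Finset.sum_le_sum_of_subset_of_nonneg (Finset.range_mono hmn)
      fun j _ _ => (hγ j).1.le
  -- T covers the small dimensions; beyond N + 2 the limsup bound applies and d ≥ 2 makes log d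
  -- positive.
  set T := ∑ j ∈ Finset.range (N + 2), γ j
  have hT : 0 ≤ T := Finset.sum_nonneg fun j _ => (hγ j).1.le
  have hsum : ∀ d : ℕ, 1 ≤ d → ∑ j ∈ Finset.range d, γ j ≤ T + |A| * Real.log d := by
    intro d hd
    have hlog0 : 0 ≤ Real.log d := Real.log_natCast_nonneg d
    rcases le_total d (N + 2) with hdN | hdN
    · have := hmono d (N + 2) hdN
      have : 0 ≤ |A| * Real.log d := by positivity
      linarith
    · have h1 := EReal.coe_lt_coe_iff.1 (hN d (by omega))
      have hlog : 0 < Real.log d := Real.log_pos (by exact_mod_cast (by omega : 1 < d))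
      rw [div_lt_iff₀ hlog] at h1
      have := mul_le_mul_of_nonneg_right (le_abs_self A) hlog.le
      linarith
  -- The added 1 keeps the exponent of d positive even if A = 0.
  refine ⟨Real.exp (b / (1 - b) * T), 2, b / (1 - b) * |A| + 1, Real.exp_pos _, two_pos,
    by positivity, fun d hd ε hε0 hε1 => (nMin_expWeightMulti_le hω hγ hb1 hb d hε0 hε1).trans
      (ENNReal.ofReal_le_ofReal (mul_le_mul_of_nonneg_right ?_ (by positivity)))⟩
  have hd0 : (0 : ℝ) < d := by exact_mod_cast hd
  rw [Real.rpow_def_of_pos hd0, ← Real.exp_add, Real.exp_le_exp]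
  have h1 := mul_le_mul_of_nonneg_left (hsum d hd) hC
  have hlog0 : 0 ≤ Real.log d := Real.log_natCast_nonneg d
  nlinarith

end

end HermiteQMC

/-- The limsup is taken in `EReal` because the real-valued one has a default value on unbounded
sequences. The quotients at d = 0 and d = 1, where the logarithm is 0, do not affect it. -/
theorem mainTheorem2 (γ ω : ℕ → ℝ)
    (hγ : ∀ j, γ j ∈ Set.Ioo (0 : ℝ) 1) (hγ_anti : Antitone γ)
    (hω : ∀ j, ω j ∈ Set.Ioo (0 : ℝ) 1)
    (hω_inf : 0 < Filter.liminf ω Filter.atTop)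
    (hω_sup : Filter.limsup ω Filter.atTop < 1) :
    (HermiteQMC.StronglyPolynomiallyTractable (HermiteQMC.expWeightMulti ω γ) ↔ Summable γ) ∧
    (HermiteQMC.PolynomiallyTractable (HermiteQMC.expWeightMulti ω γ) ↔
      Filter.limsup
        (fun d : ℕ => (((∑ j ∈ Finset.range d, γ j) / Real.log (d : ℝ) : ℝ) : EReal))
        Filter.atTop < ⊤) := by
  obtain ⟨a, b, ha0, hb1, hab⟩ := HermiteQMC.exists_bounds_of_liminf_limsup hω hω_inf hω_sup
  have ha := fun j => (hab j).1
  have hb := fun j => (hab j).2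
  exact ⟨⟨HermiteQMC.summable_of_stronglyPolynomiallyTractable hω hγ ha0 ha,
      HermiteQMC.stronglyPolynomiallyTractable_of_summable hω hγ hb1 hb⟩,
    ⟨HermiteQMC.limsup_lt_top_of_polynomiallyTractable hω hγ ha0 ha,
      HermiteQMC.polynomiallyTractable_of_limsup_lt_top hω hγ hb1 hb⟩⟩
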